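/- **Setting.** Let $K_a,K_d\in\mathbb N$, $\sigma>0$, $\mathcal A_a>0$ and $\mathcal P_1,\dots,\mathcal P_{K_d},\mathcal A_1,\dots,\mathcal A_{K_d}>0$. In each channel use the Gaussian multiple access channel maps the real inputs of the transmitters to their sum plus independent noise distributed as $\mathcal N(0,\sigma^2)$. Logarithms are natural. A *scheme* of block length $n$ consists of numbers $L, M_1,\dots,M_{K_d}$, analog encoders $\mathcal E_k:[-1,1]^L\to\mathbb R^n$ ($k\le K_a$), digital encoders $\mathcal F_k:\{1,\dots,M_k\}\to\mathbb R^n$ ($k\le K_d$) and a decoder that maps the channel output $Y^n$ to message estimates $\hat m_1,\dots,\hat m_{K_d}$ and real numbers $\hat f_1,\dots,\hat f_L$. Its digital rates are $\log(M_k)/n$ and its analog rate is $L/n$. Digital rates $R=(R_1,\dots,R_{K_d})\in[0,\infty)^{K_d}$, analog rate $\beta$ and analog error $V$ are *achievable* if there is a scheme for each block length $n\ge1$ such that 1. for every $n$, the digital rates are at least $R_1,\dots,R_{K_d}$ and the analog rate is at least $\beta$; 2. for every $n$, $\|\mathcal E_k(s)\|_\infty\le\mathcal A_a$, $\|\mathcal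 F_k(m)\|_\infty\le\mathcal A_k$ and $\frac1n\|\mathcal F_k(m)\|_2^2\le\mathcal P_k$ for all transmitters $k$, all $s\in[-1,1]^L$ and all messages $m$; 3. the probability that some message estimate is wrong, under independent uniform messages, tends to $0$ as $n\to\infty$, uniformly in the analog values; 4. for all except finitely many $n$, $\mathbb E\big[(s_{1,\ell}+\dots+s_{K_a,\ell}-\hat f_\ell)^2\big]\le V$ for every $\ell\le L$, all analog values $s_{k,\ell}\in[-1,1]$ and all messages. Let $\mathcal C(\beta,V)\subseteq\mathbb R^{K_d}$ be the closure of the set of all $R$ for which $R,\beta,V$ are achievable. Let $\mathcal C_{\mathrm{MAC}}(\mathcal P_1,\dots,\mathcal P_{K_d};\mathcal A_1,\dots,\mathcal A_{K_d})$ be the capacity region of the same channel with only the $K_d$ digital transmitters: the closure of the set of tuples $R\in[0,\infty)^{K_d}$ for which there are codes of every block length $n\ge1$, of rates at least $R$, with codewords of amplitude at most $\mathcal A_k$ and average power at most $\mathcal P_k$, whose average decoding error probability tends to $0$. Write $C(x)=\frac12\log(1+x)$ and $x^+=\max(x,0)$. **Theorem 1.** Let $\beta\in(0,1)$, $\beta'=\min\{1/n:\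 n\in\mathbb N,\ n\ge 1,\ 1/n>\beta\}$ and $V=\beta'\sigma^2/\mathcal A_a^2$. Then $$\mathcal I\ \subseteq\ \mathcal C(\beta,V)\ \subseteq\ \mathcal O,$$ where $$\mathcal I=(1-\beta')\cdot\mathcal C_{\mathrm{MAC}}\Big(\tfrac{\mathcal P_1}{1-\beta},\dots,\tfrac{\mathcal P_{K_d}}{1-\beta};\ \tfrac{\sqrt2-1}{\sqrt2}\mathcal A_1,\dots,\tfrac{\sqrt2-1}{\sqrt2}\mathcal A_{K_d}\Big)$$ and $\mathcal O$ is the set of all $R\in\mathbb R^{K_d}$ such that for every $J\subseteq\{1,\dots,K_d\}$ $$\sum_{j\in J}R_j\ \le\ \min_{k\in\{0,\dots,K_a\}}\left[C\!\left(\frac{\sum_{j\in J}\mathcal P_j+k^2\mathcal A_a^2}{\sigma^2}\right)-\left(\frac\beta2\log\frac{2k^2}{\pi eV}\right)^{+}\right]$$ (for $k=0$ the subtracted term is $0$). -/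

import Mathlib

open MeasureTheory ProbabilityTheory Filter Topology

noncomputable section

/-! ### The additive white Gaussian noise multiple access channel -/

/-- Law of `n` i.i.d. `N(0, σ²)` noise samples. -/
def noiseLaw (σ : ℝ) (n : ℕ) : Measure (Fin n → ℝ) :=
  Measure.pi fun _ => gaussianReal 0 (σ ^ 2).toNNReal

/-- Law of the channel output `Yⁿ`, `Y_i = ∑ₖ X_{k,i} + N_i`, of `n` uses of the Gaussian multiple
access channel when transmitter `k` sends the sequence `x k`. -/
def macOutputLaw (σ : ℝ) {ι : Type} [Fintype ι] {n : ℕ} (x : ι → Fin n → ℝ) :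
    Measure (Fin n → ℝ) :=
  (noiseLaw σ n).map fun z => ∑ k, x k + z

/-- Peak amplitude constraint: maximum norm at most `a` (the norm of `Fin n → ℝ` is the maximum
norm). -/
def AmplitudeBounded {n : ℕ} (a : ℝ) (x : Fin n → ℝ) : Prop :=
  ‖x‖ ≤ a

/-- Average power constraint: `(1/n) ‖x‖₂² ≤ p`. -/
def PowerBounded {n : ℕ} (p : ℝ) (x : Fin n → ℝ) : Prop :=
  (1 / (n : ℝ)) * ∑ i, x i ^ 2 ≤ p

/-! ### Digital communication only -/

/-- A code of block length `n` for the multiple access channel with `K` transmitters; the message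
set of transmitter `k` is `Fin (M k)`. (The decoder forces every `M k` to be positive.) -/
structure MacCode (K n : ℕ) where
  M : Fin K → ℕ
  enc : (k : Fin K) → Fin (M k) → Fin n → ℝ
  dec : (Fin n → ℝ) → (k : Fin K) → Fin (M k)
  measurable_dec : Measurable dec

/-- Average decoding error probability of a code (uniform messages). -/
def MacCode.error {K n : ℕ} (c : MacCode K n) (σ : ℝ) : ℝ :=
  (∏ k, (c.M k : ℝ))⁻¹ *
    ∑ m : (k : Fin K) → Fin (c.M k),
      (macOutputLaw σ fun k => c.enc k (m k)).real {y | c.dec y ≠ m}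

/-- Achievability of the rate tuple `R` over the Gaussian multiple access channel under average
power constraints `P` and amplitude constraints `A`. -/
def MacAchievable {K : ℕ} (σ : ℝ) (P A R : Fin K → ℝ) : Prop :=
  (∀ k, 0 ≤ R k) ∧
  ∃ c : (n : ℕ) → MacCode K n,
    (∀ n, 0 < n → ∀ k, R k ≤ Real.log ((c n).M k) / n) ∧
    (∀ n, 0 < n → ∀ k m,
      PowerBounded (P k) ((c n).enc k m) ∧ AmplitudeBounded (A k) ((c n).enc k m)) ∧
    Tendsto (fun n => (c n).error σ) atTop (𝓝 0)

/-- Capacity region of the Gaussian multiple access channel under average power and amplitude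
constraints. -/
def macCapacity {K : ℕ} (σ : ℝ) (P A : Fin K → ℝ) : Set (Fin K → ℝ) :=
  closure {R | MacAchievable σ P A R}

/-! ### Simultaneous digital communication and over-the-air computation -/

/-- A scheme of block length `n` with `Ka` analog and `Kd` digital transmitters. Analog
transmitter `k` holds `L` values in `[-1, 1]`, digital transmitter `k` holds a message in
`Fin (M k)`; from the channel output the receiver produces estimates of the messages and of the
`L` function values. -/
structure SoccScheme (Ka Kd n : ℕ) where
  L : ℕ
  M : Fin Kd → ℕ
  analogEnc : Fin Ka → (Fin L → Set.Icc (-1 : ℝ) 1) → Fin n → ℝ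
  measurable_analogEnc : ∀ k, Measurable (analogEnc k)
  digitalEnc : (k : Fin Kd) → Fin (M k) → Fin n → ℝ
  digitalDec : (Fin n → ℝ) → (k : Fin Kd) → Fin (M k)
  measurable_digitalDec : Measurable digitalDec
  analogDec : (Fin n → ℝ) → Fin L → ℝ
  measurable_analogDec : Measurable analogDec

namespace SoccScheme

/-- Law of the channel output given the analog values `s` and the digital messages `m`. -/
def outputLaw {Ka Kd n : ℕ} (S : SoccScheme Ka Kd n) (σ : ℝ)
    (s : Fin Ka → Fin S.L → Set.Icc (-1 : ℝ) 1) (m : (k : Fin Kd) → Fin (S.M k)) :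
    Measure (Fin n → ℝ) :=
  macOutputLaw σ (ι := Fin Ka ⊕ Fin Kd) <|
    Sum.elim (fun k => S.analogEnc k (s k)) (fun k => S.digitalEnc k (m k))

/-- Probability, under uniform messages, that some message is decoded wrongly, for given analog
values `s`. -/
def digitalError {Ka Kd n : ℕ} (S : SoccScheme Ka Kd n) (σ : ℝ)
    (s : Fin Ka → Fin S.L → Set.Icc (-1 : ℝ) 1) : ℝ :=
  (∏ k, (S.M k : ℝ))⁻¹ *
    ∑ m : (k : Fin Kd) → Fin (S.M k), (S.outputLaw σ s m).real {y | S.digitalDec y ≠ m}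

/-- Every estimate approximates the sum of the corresponding analog values with mean squared error
at most `V`, for all analog values and all digital messages. -/
def ApproximatesSums {Ka Kd n : ℕ} (S : SoccScheme Ka Kd n) (σ V : ℝ) : Prop :=
  ∀ (ℓ : Fin S.L) (s : Fin Ka → Fin S.L → Set.Icc (-1 : ℝ) 1) (m : (k : Fin Kd) → Fin (S.M k)),
    ∫⁻ y, ENNReal.ofReal ((∑ k, (s k ℓ : ℝ) - S.analogDec y ℓ) ^ 2) ∂(S.outputLaw σ s m)
      ≤ ENNReal.ofReal V

/-- The amplitude constraint of the analog transmitters and the amplitude and average power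
constraints of the digital transmitters. -/
def MeetsConstraints {Ka Kd n : ℕ} (S : SoccScheme Ka Kd n) (Aa : ℝ) (P A : Fin Kd → ℝ) : Prop :=
  (∀ k s, AmplitudeBounded Aa (S.analogEnc k s)) ∧
  ∀ k m, AmplitudeBounded (A k) (S.digitalEnc k m) ∧ PowerBounded (P k) (S.digitalEnc k m)

end SoccScheme

/-- Achievability of digital rates `R` together with analog rate `β` and analog error `V`. The
digital decoding error tends to `0` uniformly in the analog values. -/
def SoccAchievable (Ka : ℕ) {Kd : ℕ} (σ Aa : ℝ) (P A : Fin Kd → ℝ) (β V : ℝ)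
    (R : Fin Kd → ℝ) : Prop :=
  (∀ k, 0 ≤ R k) ∧
  ∃ S : (n : ℕ) → SoccScheme Ka Kd n,
    (∀ n, 0 < n → ∀ k, R k ≤ Real.log ((S n).M k) / n) ∧
    (∀ n, 0 < n → β ≤ ((S n).L : ℝ) / n) ∧
    (∀ n, 0 < n → (S n).MeetsConstraints Aa P A) ∧
    (∀ ε > 0, ∀ᶠ n in atTop, ∀ s, (S n).digitalError σ s ≤ ε) ∧
    (∀ᶠ n in atTop, (S n).ApproximatesSums σ V)

/-- The region of digital rates for analog rate `β` and analog error `V`. -/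
def soccCapacity (Ka : ℕ) {Kd : ℕ} (σ Aa : ℝ) (P A : Fin Kd → ℝ) (β V : ℝ) :
    Set (Fin Kd → ℝ) :=
  closure {R | SoccAchievable Ka σ Aa P A β V R}

/-! ### The inner and outer regions -/

/-- The inner region: the constrained capacity region of the multiple access channel with powers
`P / (1 - β)` and amplitudes `A / (√2 / (√2 - 1))`, scaled by `1 - β'`. For `β' < 1` this is the
set of all `R` such that `R / (1 - β')` lies in that capacity region; for `β' = 1` it is `{0}`. -/
def soccInner {Kd : ℕ} (σ : ℝ) (P A : Fin Kd → ℝ) (β β' : ℝ) : Set (Fin Kd → ℝ) :=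
  {R | ∃ R' ∈ macCapacity σ (fun k => P k / (1 - β)) (fun k => A k / (√2 / (√2 - 1))),
    ∀ k, R k = (1 - β') * R' k}

/-- Gaussian capacity function. -/
def gaussianCapacity (x : ℝ) : ℝ :=
  1 / 2 * Real.log (1 + x)

/-- The outer region. For `k = 0` the subtracted positive part is `0`, both with the convention
`log 0 = -∞` and with `Real.log 0 = 0`. -/
def soccOuter (Ka : ℕ) {Kd : ℕ} (σ Aa : ℝ) (P : Fin Kd → ℝ) (β V : ℝ) : Set (Fin Kd → ℝ) :=
  {R | ∀ J : Finset (Fin Kd),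
    ∑ j ∈ J, R j ≤
      (Finset.range (Ka + 1)).inf' Finset.nonempty_range_add_one fun k =>
        gaussianCapacity ((∑ j ∈ J, P j + (k : ℝ) ^ 2 * Aa ^ 2) / σ ^ 2) -
          max (β / 2 * Real.log (2 * (k : ℝ) ^ 2 / (Real.pi * Real.exp 1 * V))) 0}

end


/-!
Converse: let the first `k` analog transmitters send the same uniform value in each of the `L`
coordinates, let the messages with index in `J` be uniform and fix the other ones. The input then
has mean power at most `∑ j ∈ J, P j + k² Aa²` after centering, so the information that it shares
with the output is at most `n` times the corresponding Gaussian capacity. By the variational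
formula for relative entropy, this also bounds, up to the logarithm of an exponential moment, the
mean of every score of the source given the output. The score that rewards a correct decision by
`∑ j ∈ J, log (M j)`, plus the log-likelihood ratio of a Gaussian law of variance `V` around the
estimates against the uniform law, has mean about
`∑ j ∈ J, log (M j) + (L / 2) log (2 k² / (π e V))` and exponential moment at most `2`.

Achievability: with `β' = 1 / N`, each analog value is repeated `N` times at full amplitude, and
averaging leaves the error `σ² / (N Aa²)`. The codewords for the digital messages are sent in the
orthogonal complement, where the noise is again white. Expanding them in a balanced variant of the
Haar basis multiplies their amplitude by at most `2 + √2 = √2 / (√2 - 1)`.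
-/

open scoped NNReal ENNReal

theorem integral_le_log_of_lintegral_exp_le {Ω : Type*} [MeasurableSpace Ω] {μ : Measure Ω}
    [IsProbabilityMeasure μ] {f : Ω → ℝ} (hf : Integrable f μ) {C : ℝ} (hC : 0 < C)
    (h : ∫⁻ ω, ENNReal.ofReal (Real.exp (f ω)) ∂μ ≤ ENNReal.ofReal C) :
    ∫ ω, f ω ∂μ ≤ Real.log C := by
  have hm : AEStronglyMeasurable (fun ω => Real.exp (f ω)) μ :=
    Real.continuous_exp.comp_aestronglyMeasurable hf.1
  have h0 : 0 ≤ᵐ[μ] fun ω => Real.exp (f ω) := ae_of_all _ fun ω => (Real.exp_pos _).le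
  have hint : Integrable (fun ω => Real.exp (f ω)) μ :=
    ⟨hm, (hasFiniteIntegral_iff_ofReal h0).2 (h.trans_lt ENNReal.ofReal_lt_top)⟩
  rw [Real.le_log_iff_exp_le hC]
  calc Real.exp (∫ ω, f ω ∂μ) ≤ ∫ ω, Real.exp (f ω) ∂μ :=
        convexOn_exp.map_integral_le Real.continuous_exp.continuousOn isClosed_univ
          (ae_of_all _ fun _ => Set.mem_univ _) hf hint
    _ ≤ C := by
        rw [integral_eq_lintegral_of_nonneg_ae h0 hm]
        exact ENNReal.toReal_le_of_le_ofReal hC.le h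

section PiMeasure

variable {ι : Type*} [Fintype ι] {E : ι → Type*} {mE : ∀ i, MeasurableSpace (E i)}
  (μ : (i : ι) → Measure (E i)) [∀ i, IsProbabilityMeasure (μ i)]

theorem lintegral_pi_prod {f : (i : ι) → E i → ℝ≥0∞} (hf : ∀ i, Measurable (f i)) :
    ∫⁻ x, ∏ i, f i (x i) ∂(Measure.pi μ) = ∏ i, ∫⁻ x, f i x ∂(μ i) := by
  rw [lintegral_prod_eq_prod_lintegral_of_indepFun Finset.univ
    (fun i (x : (i : ι) → E i) => f i (x i)) (iIndepFun_pi fun i => (hf i).aemeasurable)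
    fun i => (hf i).comp (measurable_pi_apply i)]
  exact Finset.prod_congr rfl fun i _ => (measurePreserving_eval μ i).lintegral_comp (hf i)

theorem pi_withDensity_prod {f : (i : ι) → E i → ℝ≥0∞} (hf : ∀ i, Measurable (f i))
    [∀ i, SigmaFinite ((μ i).withDensity (f i))] :
    (Measure.pi μ).withDensity (fun x => ∏ i, f i (x i)) =
      Measure.pi fun i => (μ i).withDensity (f i) := by
  classical
  refine (Measure.pi_eq fun s hs => ?_).symm
  have hind : (Set.univ.pi s).indicator (fun x => ∏ i, f i (x i)) =
      fun x => ∏ i, (s i).indicator (f i) (x i) := by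
    ext x
    simp only [Set.indicator_apply, Set.mem_univ_pi, Finset.prod_ite_zero, Finset.mem_univ,
      true_imp_iff]
  rw [withDensity_apply _ (MeasurableSet.univ_pi hs),
    ← lintegral_indicator (MeasurableSet.univ_pi hs), hind,
    lintegral_pi_prod μ fun i => (hf i).indicator (hs i)]
  exact Finset.prod_congr rfl fun i _ => by
    rw [lintegral_indicator (hs i), withDensity_apply _ (hs i)]

end PiMeasure

theorem log_gaussianPDFReal (a : ℝ) {v : ℝ≥0} (hv : v ≠ 0) (y : ℝ) :
    Real.log (gaussianPDFReal a v y) =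
      -(1 / 2 * (Real.log (2 * Real.pi) + Real.log v)) - (y - a) ^ 2 / (2 * v) := by
  have hv' : (0 : ℝ) < v := by positivity
  rw [gaussianPDFReal, Real.log_mul (by positivity) (Real.exp_pos _).ne', Real.log_exp,
    Real.log_inv, Real.log_sqrt (by positivity), Real.log_mul (by positivity) hv'.ne']
  ring

/-- The log-likelihood ratio of `N(b, T)` against `N(a, v)` at the point `y`. -/
noncomputable def gaussianLLR (a : ℝ) (v : ℝ≥0) (b : ℝ) (T : ℝ≥0) (y : ℝ) : ℝ :=
  Real.log (gaussianPDFReal b T y / gaussianPDFReal a v y)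

@[fun_prop]
theorem measurable_gaussianLLR (a : ℝ) (v : ℝ≥0) (b : ℝ) (T : ℝ≥0) :
    Measurable (gaussianLLR a v b T) :=
  ((measurable_gaussianPDFReal b T).div (measurable_gaussianPDFReal a v)).log

section GaussianLLR

variable {v T : ℝ≥0} (hv : v ≠ 0) (hT : T ≠ 0) (a b : ℝ)

include hv hT

theorem gaussianReal_withDensity_exp_gaussianLLR :
    (gaussianReal a v).withDensity (fun y => ENNReal.ofReal (Real.exp (gaussianLLR a v b T y))) =
      gaussianReal b T := by
  rw [gaussianReal_of_var_ne_zero a hv, gaussianReal_of_var_ne_zero b hT,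
    ← withDensity_mul _ (measurable_gaussianPDF a v) (by fun_prop)]
  congr 1 with y
  have ha := gaussianPDFReal_pos a v y hv
  have hb := gaussianPDFReal_pos b T y hT
  rw [Pi.mul_apply, gaussianPDF, gaussianPDF, ← ENNReal.ofReal_mul ha.le, gaussianLLR,
    Real.exp_log (div_pos hb ha), mul_div_cancel₀ _ ha.ne']

theorem gaussianLLR_add (z : ℝ) :
    gaussianLLR a v b T (a + z) = 1 / 2 * Real.log (v / T) - (2 * T : ℝ)⁻¹ * (a - b) ^ 2
      - (T : ℝ)⁻¹ * ((a - b) * z) + ((2 * v : ℝ)⁻¹ - (2 * T : ℝ)⁻¹) * z ^ 2 := by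
  rw [gaussianLLR, Real.log_div (gaussianPDFReal_pos b T _ hT).ne'
    (gaussianPDFReal_pos a v _ hv).ne', log_gaussianPDFReal b hT, log_gaussianPDFReal a hv,
    Real.log_div (by positivity) (by positivity)]
  simp only [div_eq_mul_inv, mul_inv]
  ring

section Integral

variable {Ω Ω' : Type*} [MeasurableSpace Ω] [MeasurableSpace Ω'] {μ : Measure Ω} {ν : Measure Ω'}
  [IsProbabilityMeasure μ] [IsProbabilityMeasure ν] {X : Ω → ℝ} {Z : Ω' → ℝ}

theorem integrable_gaussianLLR_add (hX : MemLp X 2 μ) (hZ : MemLp Z 2 ν) :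
    Integrable (fun p : Ω × Ω' => gaussianLLR (X p.1) v b T (X p.1 + Z p.2)) (μ.prod ν) := by
  have hXb : MemLp (fun ω => X ω - b) 2 μ := hX.sub (memLp_const b)
  simp only [gaussianLLR_add hv hT]
  exact (((integrable_const _).sub ((hXb.integrable_sq.comp_fst ν).const_mul _)).sub
    (((hXb.integrable one_le_two).mul_prod (hZ.integrable one_le_two)).const_mul _)).add
    ((hZ.integrable_sq.comp_snd μ).const_mul _)

theorem integral_gaussianLLR_add (hX : MemLp X 2 μ) (hZ : MemLp Z 2 ν) (hZ0 : ν[Z] = 0) :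
    ∫ p : Ω × Ω', gaussianLLR (X p.1) v (μ[X]) T (X p.1 + Z p.2) ∂(μ.prod ν) =
      1 / 2 * Real.log (v / T) - (2 * T : ℝ)⁻¹ * Var[X; μ]
        + ((2 * v : ℝ)⁻¹ - (2 * T : ℝ)⁻¹) * Var[Z; ν] := by
  have hXb : MemLp (fun ω => X ω - μ[X]) 2 μ := hX.sub (memLp_const _)
  have h1 : Integrable (fun p : Ω × Ω' => (2 * T : ℝ)⁻¹ * (X p.1 - μ[X]) ^ 2) (μ.prod ν) :=
    (hXb.integrable_sq.comp_fst ν).const_mul _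
  have h2 : Integrable (fun p : Ω × Ω' => (T : ℝ)⁻¹ * ((X p.1 - μ[X]) * Z p.2)) (μ.prod ν) :=
    ((hXb.integrable one_le_two).mul_prod (hZ.integrable one_le_two)).const_mul _
  have h3 : Integrable (fun p : Ω × Ω' => ((2 * v : ℝ)⁻¹ - (2 * T : ℝ)⁻¹) * Z p.2 ^ 2)
      (μ.prod ν) := (hZ.integrable_sq.comp_snd μ).const_mul _
  have h0 := integrable_const (μ := μ.prod ν) (1 / 2 * Real.log (v / T))
  simp only [gaussianLLR_add hv hT]
  refine (integral_add ((h0.sub h1).sub h2) h3).trans ?_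
  rw [integral_sub' (h0.sub h1) h2, integral_sub' h0 h1]
  simp only [integral_const_mul]
  rw [integral_fun_fst (fun ω => (X ω - μ[X]) ^ 2), integral_fun_snd (fun ω => Z ω ^ 2),
    integral_prod_mul (fun ω => X ω - μ[X]) Z, hZ0, variance_eq_integral hX.1.aemeasurable,
    variance_of_integral_eq_zero hZ.1.aemeasurable hZ0]
  simp

end Integral

end GaussianLLR

section Noise

variable (σ : ℝ) {n : ℕ}

instance isProbabilityMeasure_noiseLaw : IsProbabilityMeasure (noiseLaw σ n) := by
  unfold noiseLaw; infer_instance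

theorem measurePreserving_noiseLaw_eval (i : Fin n) :
    MeasurePreserving (Function.eval i) (noiseLaw σ n) (gaussianReal 0 (σ ^ 2).toNNReal) :=
  measurePreserving_eval (fun _ : Fin n => gaussianReal 0 (σ ^ 2).toNNReal) i

theorem memLp_noiseLaw_eval (i : Fin n) : MemLp (fun z => z i) 2 (noiseLaw σ n) :=
  (memLp_id_gaussianReal 2).comp_measurePreserving (measurePreserving_noiseLaw_eval σ i)

theorem integral_noiseLaw_eval (i : Fin n) : ∫ z, z i ∂(noiseLaw σ n) = 0 := by
  rw [← integral_id_gaussianReal (μ := 0) (v := (σ ^ 2).toNNReal),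
    ← (measurePreserving_noiseLaw_eval σ i).map_eq,
    integral_map (measurePreserving_noiseLaw_eval σ i).aemeasurable (by fun_prop)]

theorem variance_noiseLaw_eval (i : Fin n) : Var[fun z => z i; noiseLaw σ n] = σ ^ 2 := by
  rw [← Real.coe_toNNReal _ (sq_nonneg σ), ← variance_id_gaussianReal (μ := 0)]
  exact (measurePreserving_noiseLaw_eval σ i).variance_fun_comp aemeasurable_id

theorem noiseLaw_map_const_add (x : Fin n → ℝ) :
    (noiseLaw σ n).map (fun z => x + z) =
      Measure.pi fun i => gaussianReal (x i) (σ ^ 2).toNNReal := by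
  have hi : ∀ i, (gaussianReal 0 (σ ^ 2).toNNReal).map (fun t => x i + t) =
      gaussianReal (x i) (σ ^ 2).toNNReal := fun i => by
    rw [gaussianReal_map_const_add, zero_add]
  have (i : Fin n) : SigmaFinite ((gaussianReal 0 (σ ^ 2).toNNReal).map (fun t => x i + t)) := by
    rw [hi]; infer_instance
  exact (Measure.pi_map_pi (μ := fun _ : Fin n => gaussianReal 0 (σ ^ 2).toNNReal)
    (f := fun i t => x i + t) fun i => by fun_prop).trans (by simp only [hi])

variable {σ}

theorem lintegral_noiseLaw_mul_exp_gaussianLLR (hσ : 0 < σ) (x b : Fin n → ℝ) {T : ℝ≥0}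
    (hT : T ≠ 0) {F : (Fin n → ℝ) → ℝ≥0∞} (hF : Measurable F) :
    ∫⁻ z, F (x + z) * ENNReal.ofReal
        (Real.exp (∑ i, gaussianLLR (x i) (σ ^ 2).toNNReal (b i) T (x i + z i))) ∂(noiseLaw σ n) =
      ∫⁻ y, F y ∂(Measure.pi fun i => gaussianReal (b i) T) := by
  have hv : (σ ^ 2).toNNReal ≠ 0 := (Real.toNNReal_pos.2 (by positivity)).ne'
  have hd := fun i => gaussianReal_withDensity_exp_gaussianLLR hv hT (x i) (b i)
  have (i : Fin n) : SigmaFinite ((gaussianReal (x i) (σ ^ 2).toNNReal).withDensity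
      (fun y => ENNReal.ofReal (Real.exp (gaussianLLR (x i) (σ ^ 2).toNNReal (b i) T y)))) := by
    rw [hd]; infer_instance
  have hpi := pi_withDensity_prod (fun i : Fin n => gaussianReal (x i) (σ ^ 2).toNNReal)
    (f := fun i y => ENNReal.ofReal (Real.exp (gaussianLLR (x i) (σ ^ 2).toNNReal (b i) T y)))
    (fun i => by fun_prop)
  simp only [hd] at hpi
  rw [← hpi, ← noiseLaw_map_const_add, lintegral_withDensity_eq_lintegral_mul _ (by fun_prop) hF,
    lintegral_map (by fun_prop) (by fun_prop)]
  refine lintegral_congr fun z => ?_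
  rw [Real.exp_sum, ENNReal.ofReal_prod_of_nonneg fun i _ => (Real.exp_pos _).le]
  simp only [Pi.mul_apply, Pi.add_apply, mul_comm]

end Noise

section ScoreBound

variable {Ω : Type*} [MeasurableSpace Ω] {μ : Measure Ω} [IsProbabilityMeasure μ] {σ : ℝ}
  {n : ℕ} {x : Ω → Fin n → ℝ}

theorem neg_mul_gaussianCapacity_le_integral_sum_gaussianLLR (hσ : 0 < σ)
    (hx2 : ∀ i, MemLp (fun ω => x ω i) 2 μ) {P : ℝ} (hP : 0 ≤ P)
    (hvar : ∑ i, Var[fun ω => x ω i; μ] ≤ n * P) :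
    -(n * gaussianCapacity (P / σ ^ 2)) ≤
      ∫ p : Ω × (Fin n → ℝ), ∑ i, gaussianLLR (x p.1 i) (σ ^ 2).toNNReal (∫ ω, x ω i ∂μ)
        (σ ^ 2 + P).toNNReal (x p.1 i + p.2 i) ∂(μ.prod (noiseLaw σ n)) := by
  have hv : (σ ^ 2).toNNReal ≠ 0 := (Real.toNNReal_pos.2 (by positivity)).ne'
  have hT : (σ ^ 2 + P).toNNReal ≠ 0 := (Real.toNNReal_pos.2 (by positivity)).ne'
  have hz := memLp_noiseLaw_eval σ (n := n)
  rw [integral_finsetSum _ fun i _ => integrable_gaussianLLR_add hv hT _ (hx2 i) (hz i)]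
  simp only [integral_gaussianLLR_add hv hT (hx2 _) (hz _) (integral_noiseLaw_eval σ _),
    variance_noiseLaw_eval, Finset.sum_add_distrib, Finset.sum_sub_distrib, ← Finset.mul_sum,
    Finset.sum_const, Finset.card_univ, Fintype.card_fin, nsmul_eq_mul,
    Real.coe_toNNReal _ (sq_nonneg σ), Real.coe_toNNReal _ (show 0 ≤ σ ^ 2 + P by positivity)]
  have hlog : Real.log (σ ^ 2 / (σ ^ 2 + P)) = -Real.log (1 + P / σ ^ 2) := by
    rw [← Real.log_inv]; congr 1; field_simp
  have hsum : (2 * (σ ^ 2 + P))⁻¹ * ∑ i, Var[fun ω => x ω i; μ] ≤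
      (2 * (σ ^ 2 + P))⁻¹ * (n * P) := by gcongr
  have hcancel : ((2 * σ ^ 2)⁻¹ - (2 * (σ ^ 2 + P))⁻¹) * (n * σ ^ 2) =
      (2 * (σ ^ 2 + P))⁻¹ * (n * P) := by
    field_simp; ring
  rw [hlog, hcancel, gaussianCapacity]
  linarith

theorem lintegral_exp_add_sum_gaussianLLR_le (hσ : 0 < σ) (hx : Measurable x) (b : Fin n → ℝ)
    {T : ℝ≥0} (hT : T ≠ 0) {g : Ω → (Fin n → ℝ) → ℝ} (hg : Measurable (Function.uncurry g))
    {C : ℝ≥0∞} (hC : ∀ y, ∫⁻ ω, ENNReal.ofReal (Real.exp (g ω y)) ∂μ ≤ C) :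
    ∫⁻ p : Ω × (Fin n → ℝ), ENNReal.ofReal (Real.exp (g p.1 (x p.1 + p.2) +
      ∑ i, gaussianLLR (x p.1 i) (σ ^ 2).toNNReal (b i) T (x p.1 i + p.2 i)))
        ∂(μ.prod (noiseLaw σ n)) ≤ C := by
  have hv : (σ ^ 2).toNNReal ≠ 0 := (Real.toNNReal_pos.2 (by positivity)).ne'
  have : Measurable fun p : Ω × (Fin n → ℝ) => g p.1 (x p.1 + p.2) :=
    hg.comp (f := fun p : Ω × (Fin n → ℝ) => (p.1, x p.1 + p.2)) (by fun_prop)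
  have hexp : Measurable (Function.uncurry fun ω y => ENNReal.ofReal (Real.exp (g ω y))) :=
    (Real.measurable_exp.comp hg).ennreal_ofReal
  rw [lintegral_prod _ (by simp only [gaussianLLR_add hv hT]; fun_prop)]
  simp only [Real.exp_add, ENNReal.ofReal_mul (Real.exp_pos _).le]
  calc _ = ∫⁻ ω, ∫⁻ y, ENNReal.ofReal (Real.exp (g ω y))
          ∂(Measure.pi fun i => gaussianReal (b i) T) ∂μ :=
        lintegral_congr fun ω => lintegral_noiseLaw_mul_exp_gaussianLLR hσ (x ω) b hT
          (hexp.comp measurable_prodMk_left)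
    _ = ∫⁻ y, ∫⁻ ω, ENNReal.ofReal (Real.exp (g ω y)) ∂μ
          ∂(Measure.pi fun i => gaussianReal (b i) T) :=
        lintegral_lintegral_swap hexp.aemeasurable
    _ ≤ ∫⁻ _, C ∂(Measure.pi fun i => gaussianReal (b i) T) := lintegral_mono hC
    _ = C := by rw [lintegral_const, measure_univ, mul_one]

/-- In information-theoretic terms, the mean of a score is at most the logarithm of its
exponential moment plus the mutual information of the input and the output, and the latter is
bounded by the relative entropy with respect to the Gaussian law with the mean of the input. -/
theorem integral_score_le_log_add_gaussianCapacity (hσ : 0 < σ) (hx : Measurable x)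
    (hx2 : ∀ i, MemLp (fun ω => x ω i) 2 μ) {P : ℝ} (hP : 0 ≤ P)
    (hvar : ∑ i, Var[fun ω => x ω i; μ] ≤ n * P)
    {g : Ω → (Fin n → ℝ) → ℝ} (hg : Measurable (Function.uncurry g)) {C : ℝ} (hC0 : 0 < C)
    (hC : ∀ y, ∫⁻ ω, ENNReal.ofReal (Real.exp (g ω y)) ∂μ ≤ ENNReal.ofReal C)
    (hint : Integrable (fun p : Ω × (Fin n → ℝ) => g p.1 (x p.1 + p.2)) (μ.prod (noiseLaw σ n))) :
    ∫ p : Ω × (Fin n → ℝ), g p.1 (x p.1 + p.2) ∂(μ.prod (noiseLaw σ n)) ≤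
      Real.log C + n * gaussianCapacity (P / σ ^ 2) := by
  have hv : (σ ^ 2).toNNReal ≠ 0 := (Real.toNNReal_pos.2 (by positivity)).ne'
  have hT : (σ ^ 2 + P).toNNReal ≠ 0 := (Real.toNNReal_pos.2 (by positivity)).ne'
  have hllr := integrable_finsetSum Finset.univ fun i _ =>
    integrable_gaussianLLR_add hv hT (∫ ω, x ω i ∂μ) (hx2 i) (memLp_noiseLaw_eval σ i)
  have hle := integral_le_log_of_lintegral_exp_le (hint.add hllr) hC0
    (lintegral_exp_add_sum_gaussianLLR_le hσ hx (fun i => ∫ ω, x ω i ∂μ) hT hg hC)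
  have hcap := neg_mul_gaussianCapacity_le_integral_sum_gaussianLLR hσ hx2 hP hvar
  rw [integral_add' hint hllr] at hle
  linarith

end ScoreBound

/-! ### Uniform messages and analog values -/

section UniformOrDirac

variable {α : Type*} [MeasurableSpace α]

/-- The uniform law on a finite type if `p` holds, and the point mass at `a` otherwise. -/
noncomputable def uniformOrDirac (p : Prop) [Decidable p] (a : α) : Measure α :=
  if p then uniformOn Set.univ else Measure.dirac a

variable (p : Prop) [Decidable p] (a b : α)

instance isProbabilityMeasure_uniformOrDirac [Finite α] :
    IsProbabilityMeasure (uniformOrDirac p a) := by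
  have : Nonempty α := ⟨a⟩
  unfold uniformOrDirac
  split_ifs <;> infer_instance

variable [Fintype α] [MeasurableSingletonClass α]

theorem uniformOrDirac_real_singleton [DecidableEq α] :
    (uniformOrDirac p a).real {b} =
      if p then (Fintype.card α : ℝ)⁻¹ else if a = b then 1 else 0 := by
  unfold uniformOrDirac
  split_ifs with hp hab
  · simp [measureReal_def, uniformOn_univ]
  · simp [measureReal_def, hab]
  · simp [measureReal_def, hab]

theorem sum_uniformOrDirac_real_singleton : ∑ a, (uniformOrDirac p a).real {b} = 1 := by
  classical
  have : Nonempty α := ⟨b⟩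
  simp only [uniformOrDirac_real_singleton]
  split_ifs <;> simp

end UniformOrDirac

section MessageLaw

variable {ι : Type*} [Fintype ι] [DecidableEq ι] {α : ι → Type*}
  [∀ i, MeasurableSpace (α i)] (J : Finset ι) (a₀ : (i : ι) → α i)

/-- Independent messages; those with index in `J` are uniform, the others are fixed by `a₀`. -/
noncomputable def messageLaw : Measure ((i : ι) → α i) :=
  Measure.pi fun i => uniformOrDirac (i ∈ J) (a₀ i)

section Finite

variable [∀ i, Finite (α i)]

instance isProbabilityMeasure_messageLaw : IsProbabilityMeasure (messageLaw J a₀) := by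
  unfold messageLaw; infer_instance

theorem messageLaw_real_singleton (a : (i : ι) → α i) :
    (messageLaw J a₀).real {a} = ∏ i, (uniformOrDirac (i ∈ J) (a₀ i)).real {a i} := by
  rw [messageLaw, measureReal_def, Measure.pi_singleton, ENNReal.toReal_prod]
  rfl

theorem sum_variance_sum_messageLaw_le [∀ i, MeasurableSingletonClass (α i)] {κ : Type*}
    [Fintype κ] {F : (i : ι) → α i → κ → ℝ} {B : ι → ℝ} (hF : ∀ i c, ∑ t, F i c t ^ 2 ≤ B i) :
    ∑ t, Var[fun a => ∑ i, F i (a i) t; messageLaw J a₀] ≤ ∑ j ∈ J, B j := by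
  have hvar : ∀ t, Var[fun a => ∑ i, F i (a i) t; messageLaw J a₀] =
      ∑ j ∈ J, Var[fun c => F j c t; uniformOrDirac (j ∈ J) (a₀ j)] := fun t => by
    have hsum := variance_sum_pi (μ := fun i => uniformOrDirac (i ∈ J) (a₀ i))
      (X := fun i c => F i c t) fun i => MemLp.of_discrete
    rw [Finset.sum_fn] at hsum
    rw [messageLaw, hsum]
    refine (Finset.sum_subset (Finset.subset_univ J) fun i _ hi => ?_).symm
    simp only [uniformOrDirac, hi, if_false, variance_dirac]
  simp only [hvar]
  rw [Finset.sum_comm]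
  refine Finset.sum_le_sum fun j _ => ?_
  calc ∑ t, Var[fun c => F j c t; uniformOrDirac (j ∈ J) (a₀ j)]
      ≤ ∑ t, ∫ c, F j c t ^ 2 ∂(uniformOrDirac (j ∈ J) (a₀ j)) :=
        Finset.sum_le_sum fun t _ =>
          variance_le_expectation_sq Measurable.of_discrete.aestronglyMeasurable
    _ = ∫ c, ∑ t, F j c t ^ 2 ∂(uniformOrDirac (j ∈ J) (a₀ j)) :=
        (integral_finsetSum _ fun _ _ => Integrable.of_finite).symm
    _ ≤ ∫ _, B j ∂(uniformOrDirac (j ∈ J) (a₀ j)) :=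
        integral_mono Integrable.of_finite (integrable_const _) (hF j)
    _ = B j := by rw [integral_const, probReal_univ, one_smul]

end Finite

variable [∀ i, Fintype (α i)] [∀ i, MeasurableSingletonClass (α i)]

theorem messageLaw_real_singleton_le (a : (i : ι) → α i) :
    (messageLaw J a₀).real {a} ≤ (∏ j ∈ J, (Fintype.card (α j) : ℝ))⁻¹ := by
  classical
  calc (messageLaw J a₀).real {a}
      = ∏ i, (uniformOrDirac (i ∈ J) (a₀ i)).real {a i} := messageLaw_real_singleton J a₀ a
    _ ≤ ∏ i, if i ∈ J then (Fintype.card (α i) : ℝ)⁻¹ else 1 := by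
        refine Finset.prod_le_prod (fun i _ => measureReal_nonneg) fun i _ => ?_
        rw [uniformOrDirac_real_singleton]
        split_ifs <;> simp
    _ = (∏ j ∈ J, (Fintype.card (α j) : ℝ))⁻¹ := by
        rw [Finset.prod_ite_mem, Finset.univ_inter, Finset.prod_inv_distrib]

theorem sum_integral_messageLaw (f : ((i : ι) → α i) → ℝ) :
    ∑ a₀, ∫ a, f a ∂(messageLaw J a₀) = ∑ a, f a := by
  have hone (a : (i : ι) → α i) : ∑ a₀ : (i : ι) → α i, (messageLaw J a₀).real {a} = 1 := by
    simp only [messageLaw_real_singleton]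
    rw [← Fintype.prod_sum (fun i c => (uniformOrDirac (i ∈ J) c).real {a i})]
    simp only [sum_uniformOrDirac_real_singleton, Finset.prod_const_one]
  calc ∑ a₀, ∫ a, f a ∂(messageLaw J a₀)
      = ∑ a₀, ∑ a, (messageLaw J a₀).real {a} * f a :=
        Finset.sum_congr rfl fun a₀ _ => integral_fintype Integrable.of_finite
    _ = ∑ a, f a := by
        rw [Finset.sum_comm]
        simp only [← Finset.sum_mul, hone, one_mul]

theorem exists_integral_messageLaw_le [∀ i, Nonempty (α i)] (f : ((i : ι) → α i) → ℝ) :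
    ∃ a₀, ∫ a, f a ∂(messageLaw J a₀) ≤
      (∏ i, (Fintype.card (α i) : ℝ))⁻¹ * ∑ a, f a := by
  have hcard : ((Fintype.card ((i : ι) → α i) : ℕ) : ℝ) = ∏ i, (Fintype.card (α i) : ℝ) := by
    rw [Fintype.card_pi, Nat.cast_prod]
  obtain ⟨a₀, -, ha₀⟩ := Finset.exists_le_of_sum_le
    (f := fun a₀ => ∫ a, f a ∂(messageLaw J a₀))
    (g := fun _ => (∏ i, (Fintype.card (α i) : ℝ))⁻¹ * ∑ a, f a)
    Finset.univ_nonempty (by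
      rw [sum_integral_messageLaw, Finset.sum_const, Finset.card_univ, nsmul_eq_mul, ← hcard,
        mul_inv_cancel_left₀ (Nat.cast_ne_zero.2 Fintype.card_ne_zero)])
  exact ⟨a₀, ha₀⟩

theorem lintegral_exp_ite_log_card_messageLaw_le [DecidableEq ((i : ι) → α i)]
    (a' : (i : ι) → α i) :
    ∫⁻ a, ENNReal.ofReal (Real.exp
      (if a' = a then Real.log (∏ j ∈ J, (Fintype.card (α j) : ℝ)) else 0))
        ∂(messageLaw J a₀) ≤ 2 := by
  set N : ℝ := ∏ j ∈ J, (Fintype.card (α j) : ℝ)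
  have hN : 0 < N := Finset.prod_pos fun j _ => by
    exact_mod_cast Fintype.card_pos_iff.2 ⟨a₀ j⟩
  calc _ ≤ ∫⁻ a, 1 + Set.indicator {a'} (fun _ => ENNReal.ofReal N) a ∂(messageLaw J a₀) := by
        refine lintegral_mono fun a => ?_
        by_cases h : a' = a
        · simp [h, Real.exp_log hN]
        · simp [h, Ne.symm h]
    _ = 1 + ENNReal.ofReal N * messageLaw J a₀ {a'} := by
        rw [lintegral_add_left measurable_const,
          lintegral_indicator_const (measurableSet_singleton _), lintegral_one, measure_univ]
    _ ≤ 1 + ENNReal.ofReal N * ENNReal.ofReal N⁻¹ := by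
        gcongr
        rw [← ofReal_measureReal]
        exact ENNReal.ofReal_le_ofReal (messageLaw_real_singleton_le J a₀ a')
    _ = 2 := by
        rw [← ENNReal.ofReal_mul hN.le, mul_inv_cancel₀ hN.ne', ENNReal.ofReal_one,
          one_add_one_eq_two]

end MessageLaw

section UniformIcc

/-- The uniform law on `[-1, 1]`. -/
noncomputable def uniformIcc : Measure (Set.Icc (-1 : ℝ) 1) :=
  (2 : ℝ≥0∞)⁻¹ • volume.comap Subtype.val

instance isProbabilityMeasure_uniformIcc : IsProbabilityMeasure uniformIcc := by
  refine ⟨?_⟩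
  rw [uniformIcc, Measure.smul_apply, comap_subtype_coe_apply measurableSet_Icc, Set.image_univ,
    Subtype.range_coe, Real.volume_Icc, sub_neg_eq_add, one_add_one_eq_two, ENNReal.ofReal_ofNat,
    smul_eq_mul, ENNReal.inv_mul_cancel two_ne_zero ENNReal.ofNat_ne_top]

/-- The logarithm of the density of `N(f, V)` relative to the uniform law on `[-k, k]`, at the
point `k * t`. -/
noncomputable def uniformScore (k : ℝ) (V : ℝ≥0) (f t : ℝ) : ℝ :=
  Real.log (2 * k * gaussianPDFReal f V (k * t))

variable {k : ℝ} (hk : 0 < k) {V : ℝ≥0} (hV : V ≠ 0)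

include hk hV

theorem uniformScore_eq (f t : ℝ) :
    uniformScore k V f t =
      1 / 2 * Real.log (2 * k ^ 2 / (Real.pi * V)) - (k * t - f) ^ 2 / (2 * V) := by
  have hV' : (0 : ℝ) < V := by positivity
  have hlog : Real.log (2 * k ^ 2 / (Real.pi * V)) =
      2 * Real.log (2 * k) - (Real.log (2 * Real.pi) + Real.log V) := by
    rw [← Real.log_mul (by positivity) hV'.ne', ← Nat.cast_ofNat, ← Real.log_pow,
      ← Real.log_div (by positivity) (by positivity)]
    congr 1
    field_simp
  rw [uniformScore, Real.log_mul (by positivity) (gaussianPDFReal_pos f V _ hV).ne',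
    log_gaussianPDFReal f hV, hlog]
  ring

theorem lintegral_exp_uniformScore_le (f : ℝ) :
    ∫⁻ t : Set.Icc (-1 : ℝ) 1, ENNReal.ofReal (Real.exp (uniformScore k V f t)) ∂uniformIcc
      ≤ 1 := by
  have hexp : ∀ t, ENNReal.ofReal (Real.exp (uniformScore k V f t)) =
      2 * (ENNReal.ofReal |k| * gaussianPDF f V (k * t)) := fun t => by
    have hpdf := gaussianPDFReal_pos f V (k * t) hV
    rw [uniformScore, Real.exp_log (by positivity), abs_of_pos hk, gaussianPDF,
      ENNReal.ofReal_mul (by positivity), ENNReal.ofReal_mul zero_le_two, ENNReal.ofReal_ofNat,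
      mul_assoc]
  calc _ = 2⁻¹ * ∫⁻ t in Set.Icc (-1 : ℝ) 1,
          2 * (ENNReal.ofReal |k| * gaussianPDF f V (k * t)) := by
        simp only [hexp]
        rw [uniformIcc, lintegral_smul_measure, smul_eq_mul]
        exact congrArg _ (lintegral_subtype_comap (μ := volume) measurableSet_Icc
          fun t : ℝ => 2 * (ENNReal.ofReal |k| * gaussianPDF f V (k * t)))
    _ ≤ 2⁻¹ * ∫⁻ t, 2 * (ENNReal.ofReal |k| * gaussianPDF f V (k * t)) := by
        gcongr
        exact Measure.restrict_le_self
    _ = ∫⁻ y, gaussianPDF f V y := by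
        rw [lintegral_const_mul _ (by fun_prop), ← mul_assoc,
          ENNReal.inv_mul_cancel two_ne_zero ENNReal.ofNat_ne_top, one_mul,
          lintegral_const_mul _ (by fun_prop)]
        conv_rhs => rw [← Real.smul_map_volume_mul_left hk.ne', lintegral_smul_measure,
          lintegral_map (by fun_prop) (by fun_prop), smul_eq_mul]
    _ = 1 := lintegral_gaussianPDF_eq_one f hV

end UniformIcc

/-! ### Scores of a scheme -/

theorem measureReal_prod_eq_integral {X Y : Type*} [MeasurableSpace X] [MeasurableSpace Y]
    (μ : Measure X) (ν : Measure Y) [IsFiniteMeasure ν] {s : Set (X × Y)} (hs : MeasurableSet s) :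
    (μ.prod ν).real s = ∫ x, ν.real (Prod.mk x ⁻¹' s) ∂μ := by
  rw [measureReal_def, Measure.prod_apply hs, ← integral_toReal
    (measurable_measure_prodMk_left hs).aemeasurable (ae_of_all _ fun x => measure_lt_top _ _)]
  rfl

theorem AmplitudeBounded.abs_apply_le {n : ℕ} {a : ℝ} {x : Fin n → ℝ} (h : AmplitudeBounded a x)
    (i : Fin n) : |x i| ≤ a :=
  (norm_le_pi_norm x i).trans h

theorem PowerBounded.sum_sq_le {n : ℕ} {p : ℝ} {x : Fin n → ℝ} (h : PowerBounded p x) :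
    ∑ i, x i ^ 2 ≤ n * p := by
  rcases n.eq_zero_or_pos with rfl | hn
  · simp
  · rwa [PowerBounded, one_div, inv_mul_le_iff₀ (by positivity)] at h

/-- Analog values such that the first `k` of the `K` transmitters all hold `θ` and the others
hold `0`. The sum of the values is then `k * θ`. -/
noncomputable def repeatFirst (K k : ℕ) {L : ℕ} (θ : Fin L → Set.Icc (-1 : ℝ) 1) :
    Fin K → Fin L → Set.Icc (-1 : ℝ) 1 :=
  fun i => if (i : ℕ) < k then θ else fun _ => ⟨0, by norm_num⟩

@[fun_prop]
theorem measurable_repeatFirst (K k L : ℕ) : Measurable (repeatFirst K k (L := L)) := by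
  refine measurable_pi_lambda _ fun i => ?_
  unfold repeatFirst
  split_ifs
  · exact measurable_id
  · exact measurable_const

theorem sum_repeatFirst {K k : ℕ} (hk : k ≤ K) {L : ℕ} (θ : Fin L → Set.Icc (-1 : ℝ) 1)
    (ℓ : Fin L) : ∑ i, (repeatFirst K k θ i ℓ : ℝ) = k * θ ℓ := by
  have hval : ∀ i : Fin K, (repeatFirst K k θ i ℓ : ℝ) = if (i : ℕ) < k then (θ ℓ : ℝ) else 0 :=
    fun i => by unfold repeatFirst; split_ifs <;> rfl
  simp only [hval]
  rw [Finset.sum_ite, Finset.sum_const, Finset.sum_const_zero, add_zero, nsmul_eq_mul,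
    Fin.card_filter_val_lt, min_eq_right hk]

namespace SoccScheme

variable {Ka Kd n : ℕ} (S : SoccScheme Ka Kd n)

/-- The messages together with the values common to the transmitting analog users. -/
abbrev Source : Type :=
  ((j : Fin Kd) → Fin (S.M j)) × (Fin S.L → Set.Icc (-1 : ℝ) 1)

/-- The noiseless channel output when the messages are `w.1` and the first `k` analog transmitters
hold `w.2`. -/
noncomputable def input (k : ℕ) (w : S.Source) : Fin n → ℝ :=
  ∑ j, S.digitalEnc j (w.1 j) + ∑ i, S.analogEnc i (repeatFirst Ka k w.2 i)

theorem measurable_analogSum (k : ℕ) :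
    Measurable fun θ => ∑ i, S.analogEnc i (repeatFirst Ka k θ i) :=
  Finset.measurable_fun_sum _ fun i _ => (S.measurable_analogEnc i).comp (by fun_prop)

@[fun_prop]
theorem measurable_input (k : ℕ) : Measurable (S.input k) := by
  unfold input
  refine Measurable.add ?_ ((S.measurable_analogSum k).comp measurable_snd)
  exact (Measurable.of_discrete
    (f := fun m : (j : Fin Kd) → Fin (S.M j) => ∑ j, S.digitalEnc j (m j))).comp measurable_fst

theorem outputLaw_repeatFirst (σ : ℝ) (k : ℕ) (m : (j : Fin Kd) → Fin (S.M j))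
    (θ : Fin S.L → Set.Icc (-1 : ℝ) 1) :
    S.outputLaw σ (repeatFirst Ka k θ) m = (noiseLaw σ n).map fun z => S.input k (m, θ) + z := by
  simp [outputLaw, macOutputLaw, input, Fintype.sum_sum_type, add_comm]

/-- The law of the messages and analog values used in the converse: the analog values are
independent and uniform, and so are the messages with index in `J`, while the other messages are
fixed by `m₀`. -/
noncomputable def sourceLaw (J : Finset (Fin Kd)) (m₀ : (j : Fin Kd) → Fin (S.M j)) :
    Measure S.Source :=
  (messageLaw J m₀).prod (Measure.pi fun _ => uniformIcc)

instance isProbabilityMeasure_sourceLaw (J : Finset (Fin Kd)) (m₀ : (j : Fin Kd) → Fin (S.M j)) :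
    IsProbabilityMeasure (S.sourceLaw J m₀) := by
  unfold sourceLaw; infer_instance

section Power

variable {S} {Aa : ℝ} {P A : Fin Kd → ℝ} (hS : S.MeetsConstraints Aa P A) {k : ℕ} (hk : k ≤ Ka)

include hS hk

theorem exists_analogSum_mem_Icc (t : Fin n) :
    ∃ c, ∀ θ, (∑ i, S.analogEnc i (repeatFirst Ka k θ i)) t ∈
      Set.Icc (c - k * Aa) (c + k * Aa) := by
  set idle : Fin S.L → Set.Icc (-1 : ℝ) 1 := fun _ => ⟨0, by norm_num⟩
  refine ⟨∑ i : Fin Ka, if (i : ℕ) < k then 0 else S.analogEnc i idle t, fun θ => ?_⟩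
  rw [← Set.mem_Icc_iff_abs_le, abs_sub_comm, Finset.sum_apply, ← Finset.sum_sub_distrib]
  calc _ ≤ ∑ i : Fin Ka, if (i : ℕ) < k then Aa else 0 := by
        refine (Finset.abs_sum_le_sum_abs _ _).trans (Finset.sum_le_sum fun i _ => ?_)
        unfold repeatFirst
        split_ifs
        · simpa only [sub_zero] using (hS.1 i θ).abs_apply_le t
        · rw [sub_self, abs_zero]
    _ = k * Aa := by
        rw [Finset.sum_ite, Finset.sum_const, Finset.sum_const_zero, add_zero, nsmul_eq_mul,
          Fin.card_filter_val_lt, min_eq_right hk]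

theorem memLp_analogSum (t : Fin n) :
    MemLp (fun θ => (∑ i, S.analogEnc i (repeatFirst Ka k θ i)) t) 2
      (Measure.pi fun _ => uniformIcc) := by
  obtain ⟨c, hc⟩ := exists_analogSum_mem_Icc hS hk t
  exact memLp_of_bounded (.of_forall hc)
    ((measurable_pi_apply t).comp (S.measurable_analogSum k)).aestronglyMeasurable _

theorem variance_analogSum_le (t : Fin n) :
    Var[fun θ => (∑ i, S.analogEnc i (repeatFirst Ka k θ i)) t; Measure.pi fun _ => uniformIcc] ≤
      k ^ 2 * Aa ^ 2 := by
  obtain ⟨c, hc⟩ := exists_analogSum_mem_Icc hS hk t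
  calc _ ≤ ((c + k * Aa - (c - k * Aa)) / 2) ^ 2 := variance_le_sq_of_bounded (.of_forall hc)
        ((measurable_pi_apply t).comp (S.measurable_analogSum k)).aemeasurable
    _ = k ^ 2 * Aa ^ 2 := by ring

variable (J : Finset (Fin Kd)) (m₀ : (j : Fin Kd) → Fin (S.M j))

theorem memLp_input (t : Fin n) : MemLp (fun w => S.input k w t) 2 (S.sourceLaw J m₀) := by
  have hdigital : MemLp (fun m : (j : Fin Kd) → Fin (S.M j) => (∑ j, S.digitalEnc j (m j)) t) 2
    (messageLaw J m₀) := MemLp.of_discrete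
  exact (hdigital.comp_fst _).add ((memLp_analogSum hS hk t).comp_snd _)

theorem sum_variance_input_le :
    ∑ t, Var[fun w => S.input k w t; S.sourceLaw J m₀] ≤
      n * (∑ j ∈ J, P j + k ^ 2 * Aa ^ 2) := by
  have hsplit : ∀ t, Var[fun w => S.input k w t; S.sourceLaw J m₀] =
      Var[fun m => ∑ j, S.digitalEnc j (m j) t; messageLaw J m₀] +
        Var[fun θ => (∑ i, S.analogEnc i (repeatFirst Ka k θ i)) t;
          Measure.pi fun _ => uniformIcc] := fun t => by
    rw [← variance_add_prod MemLp.of_discrete (memLp_analogSum hS hk t)]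
    simp only [input, Pi.add_apply, Finset.sum_apply]
    rfl
  simp only [hsplit]
  rw [Finset.sum_add_distrib, mul_add, Finset.mul_sum]
  refine add_le_add
    (sum_variance_sum_messageLaw_le J m₀ fun j m => (hS.2 j m).2.sum_sq_le) ?_
  calc _ ≤ ∑ _t : Fin n, (k ^ 2 * Aa ^ 2 : ℝ) :=
        Finset.sum_le_sum fun t _ => variance_analogSum_le hS hk t
    _ = n * (k ^ 2 * Aa ^ 2) := by
        rw [Finset.sum_const, Finset.card_univ, Fintype.card_fin, nsmul_eq_mul]

end Power

section DecodingError

/-- The set of source and noise pairs for which all messages are decoded correctly. -/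
def correctSet (k : ℕ) : Set (S.Source × (Fin n → ℝ)) :=
  {p | S.digitalDec (S.input k p.1 + p.2) = p.1.1}

theorem measurableSet_correctSet (k : ℕ) : MeasurableSet (S.correctSet k) :=
  measurableSet_eq_fun (S.measurable_digitalDec.comp (by fun_prop)) (by fun_prop)

theorem digitalError_repeatFirst (σ : ℝ) (k : ℕ) (θ : Fin S.L → Set.Icc (-1 : ℝ) 1) :
    S.digitalError σ (repeatFirst Ka k θ) =
      (∏ j, (S.M j : ℝ))⁻¹ *
        ∑ m, (noiseLaw σ n).real (Prod.mk (m, θ) ⁻¹' (S.correctSet k)ᶜ) := by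
  refine congrArg _ (Finset.sum_congr rfl fun m _ => ?_)
  have hmeas : MeasurableSet {y | S.digitalDec y ≠ m} :=
    (S.measurable_digitalDec (measurableSet_singleton m)).compl
  rw [outputLaw_repeatFirst, map_measureReal_apply (by fun_prop) hmeas]
  rfl

theorem exists_le_measureReal_correctSet {σ ε : ℝ} (hε : ∀ s, S.digitalError σ s ≤ ε)
    (J : Finset (Fin Kd)) (k : ℕ) :
    ∃ m₀, 1 - ε ≤ ((S.sourceLaw J m₀).prod (noiseLaw σ n)).real (S.correctSet k) := by
  have (j : Fin Kd) : Nonempty (Fin (S.M j)) := ⟨S.digitalDec 0 j⟩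
  have hmeas := (S.measurableSet_correctSet k).compl
  have hint (m) : Integrable (fun θ => (noiseLaw σ n).real (Prod.mk (m, θ) ⁻¹' (S.correctSet k)ᶜ))
      (Measure.pi fun _ => uniformIcc) :=
    Measure.integrable_measure_prodMk_left (hmeas.preimage
      (f := fun p : (Fin S.L → Set.Icc (-1 : ℝ) 1) × (Fin n → ℝ) => ((m, p.1), p.2))
      (by fun_prop)) (measure_ne_top _ _)
  obtain ⟨m₀, hm₀⟩ := exists_integral_messageLaw_le J fun m =>
    ∫ θ, (noiseLaw σ n).real (Prod.mk (m, θ) ⁻¹' (S.correctSet k)ᶜ) ∂Measure.pi fun _ => uniformIcc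
  have herror : ((S.sourceLaw J m₀).prod (noiseLaw σ n)).real (S.correctSet k)ᶜ ≤ ε :=
    calc _ = ∫ m, ∫ θ, (noiseLaw σ n).real (Prod.mk (m, θ) ⁻¹' (S.correctSet k)ᶜ)
            ∂Measure.pi fun _ => uniformIcc ∂messageLaw J m₀ := by
          rw [measureReal_prod_eq_integral _ _ hmeas, sourceLaw, integral_prod _
            (Measure.integrable_measure_prodMk_left hmeas (measure_ne_top _ _))]
      _ ≤ ∫ θ, S.digitalError σ (repeatFirst Ka k θ) ∂Measure.pi fun _ => uniformIcc := by
          simpa only [digitalError_repeatFirst, integral_const_mul, Fintype.card_fin,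
            integral_finsetSum _ fun m _ => hint m] using hm₀
      _ ≤ ∫ _θ, ε ∂Measure.pi fun _ : Fin S.L => uniformIcc := by
          refine integral_mono ?_ (integrable_const _) fun θ => hε _
          simp only [digitalError_repeatFirst]
          exact (integrable_finsetSum _ fun m _ => hint m).const_mul _
      _ = ε := by rw [integral_const, probReal_univ, one_smul]
  rw [probReal_compl_eq_one_sub (S.measurableSet_correctSet k)] at herror
  exact ⟨m₀, by linarith⟩

end DecodingError

section Scores

/-- The score of the messages `m` given the channel output `y`: the logarithm of the number of
messages with index in `J` if `y` is decoded as `m`. -/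
noncomputable def decodingScore (J : Finset (Fin Kd)) (m : (j : Fin Kd) → Fin (S.M j))
    (y : Fin n → ℝ) : ℝ :=
  if S.digitalDec y = m then Real.log (∏ j ∈ J, (S.M j : ℝ)) else 0

/-- The score of the values `θ` given the channel output `y`: the log-likelihood ratio of
`k * θ ℓ` having the Gaussian law of variance `V` around its estimate instead of the uniform
law. -/
noncomputable def analogScore (k : ℝ) (V : ℝ≥0) (θ : Fin S.L → Set.Icc (-1 : ℝ) 1)
    (y : Fin n → ℝ) : ℝ :=
  ∑ ℓ, uniformScore k V (S.analogDec y ℓ) (θ ℓ)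

theorem measurable_decodingScore (J : Finset (Fin Kd)) :
    Measurable fun p : ((j : Fin Kd) → Fin (S.M j)) × (Fin n → ℝ) => S.decodingScore J p.1 p.2 :=
  Measurable.ite (measurableSet_eq_fun (S.measurable_digitalDec.comp measurable_snd)
    measurable_fst) measurable_const measurable_const

theorem decodingScore_input_add (J : Finset (Fin Kd)) (k : ℕ) (p : S.Source × (Fin n → ℝ)) :
    S.decodingScore J p.1.1 (S.input k p.1 + p.2) =
      (S.correctSet k).indicator (fun _ => Real.log (∏ j ∈ J, (S.M j : ℝ))) p := by
  by_cases h : S.digitalDec (S.input k p.1 + p.2) = p.1.1 <;>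
    simp [decodingScore, correctSet, h]

theorem lintegral_exp_analogScore_le {k : ℝ} (hk : 0 < k) {V : ℝ≥0} (hV : V ≠ 0)
    (y : Fin n → ℝ) :
    ∫⁻ θ, ENNReal.ofReal (Real.exp (S.analogScore k V θ y)) ∂(Measure.pi fun _ => uniformIcc)
      ≤ 1 := by
  simp only [analogScore, Real.exp_sum,
    ENNReal.ofReal_prod_of_nonneg fun _ _ => (Real.exp_pos _).le]
  rw [lintegral_pi_prod (fun _ : Fin S.L => uniformIcc)
    (f := fun ℓ t => ENNReal.ofReal (Real.exp (uniformScore k V (S.analogDec y ℓ) t)))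
    fun ℓ => by simp only [uniformScore_eq hk hV]; fun_prop]
  exact Finset.prod_le_one' fun ℓ _ => lintegral_exp_uniformScore_le hk hV _

theorem measurable_sq_sub_analogDec (k : ℝ) (ℓ : Fin S.L) :
    Measurable fun p : (Fin S.L → Set.Icc (-1 : ℝ) 1) × (Fin n → ℝ) =>
      (k * p.1 ℓ - S.analogDec p.2 ℓ) ^ 2 := by
  have hdec : Measurable fun p : (Fin S.L → Set.Icc (-1 : ℝ) 1) × (Fin n → ℝ) =>
      S.analogDec p.2 ℓ :=
    (measurable_pi_apply ℓ).comp (S.measurable_analogDec.comp measurable_snd)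
  fun_prop

theorem measurable_analogScore {k : ℝ} (hk : 0 < k) {V : ℝ≥0} (hV : V ≠ 0) :
    Measurable fun p : (Fin S.L → Set.Icc (-1 : ℝ) 1) × (Fin n → ℝ) =>
      S.analogScore k V p.1 p.2 := by
  simp only [analogScore, uniformScore_eq hk hV]
  exact Finset.measurable_fun_sum _ fun ℓ _ =>
    ((S.measurable_sq_sub_analogDec k ℓ).div_const _).const_sub _

variable {S} {k : ℕ} (hk : k ≤ Ka) (J : Finset (Fin Kd)) (m₀ : (j : Fin Kd) → Fin (S.M j))

section

variable {σ : ℝ} {V : ℝ≥0} (hS : S.ApproximatesSums σ V)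

include hk hS

theorem lintegral_sq_sub_analogDec_le (ℓ : Fin S.L) :
    ∫⁻ p, ENNReal.ofReal ((k * p.1.2 ℓ - S.analogDec (S.input k p.1 + p.2) ℓ) ^ 2)
      ∂((S.sourceLaw J m₀).prod (noiseLaw σ n)) ≤ V := by
  have hmeas : Measurable fun p : S.Source × (Fin n → ℝ) =>
      ((k : ℝ) * p.1.2 ℓ - S.analogDec (S.input k p.1 + p.2) ℓ) ^ 2 :=
    (S.measurable_sq_sub_analogDec k ℓ).comp
      (f := fun p : S.Source × (Fin n → ℝ) => (p.1.2, S.input k p.1 + p.2)) (by fun_prop)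
  rw [lintegral_prod _ hmeas.ennreal_ofReal.aemeasurable]
  calc _ ≤ ∫⁻ _w, (V : ℝ≥0∞) ∂(S.sourceLaw J m₀) := by
        refine lintegral_mono fun w => ?_
        have hsq : Measurable fun y => ENNReal.ofReal ((k * w.2 ℓ - S.analogDec y ℓ) ^ 2) :=
          ((S.measurable_sq_sub_analogDec k ℓ).comp measurable_prodMk_left).ennreal_ofReal
        have hw := hS ℓ (repeatFirst Ka k w.2) w.1
        rwa [outputLaw_repeatFirst, sum_repeatFirst hk, lintegral_map hsq (by fun_prop),
          ENNReal.ofReal_coe_nnreal] at hw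
    _ = V := by rw [lintegral_const, measure_univ, mul_one]

theorem integrable_sq_sub_analogDec (ℓ : Fin S.L) :
    Integrable (fun p => ((k : ℝ) * p.1.2 ℓ - S.analogDec (S.input k p.1 + p.2) ℓ) ^ 2)
      ((S.sourceLaw J m₀).prod (noiseLaw σ n)) := by
  refine ⟨((S.measurable_sq_sub_analogDec k ℓ).comp
    (f := fun p : S.Source × (Fin n → ℝ) => (p.1.2, S.input k p.1 + p.2))
    (by fun_prop)).aestronglyMeasurable, ?_⟩
  rw [hasFiniteIntegral_iff_ofReal (ae_of_all _ fun p => sq_nonneg _)]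
  exact (lintegral_sq_sub_analogDec_le hk J m₀ hS ℓ).trans_lt ENNReal.coe_lt_top

theorem integral_sq_sub_analogDec_le (ℓ : Fin S.L) :
    ∫ p, ((k : ℝ) * p.1.2 ℓ - S.analogDec (S.input k p.1 + p.2) ℓ) ^ 2
      ∂((S.sourceLaw J m₀).prod (noiseLaw σ n)) ≤ V := by
  rw [integral_eq_lintegral_of_nonneg_ae (ae_of_all _ fun p => sq_nonneg _)
    (integrable_sq_sub_analogDec hk J m₀ hS ℓ).aestronglyMeasurable]
  exact ENNReal.toReal_le_coe_of_le_coe (lintegral_sq_sub_analogDec_le hk J m₀ hS ℓ)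

variable (hk₀ : 0 < k) (hV : V ≠ 0)

include hk₀ hV

theorem integrable_uniformScore_analogDec (ℓ : Fin S.L) :
    Integrable (fun p => uniformScore k V (S.analogDec (S.input k p.1 + p.2) ℓ) (p.1.2 ℓ))
      ((S.sourceLaw J m₀).prod (noiseLaw σ n)) := by
  simp only [uniformScore_eq (Nat.cast_pos.2 hk₀) hV]
  exact (integrable_const _).sub ((integrable_sq_sub_analogDec hk J m₀ hS ℓ).div_const _)

theorem integrable_analogScore :
    Integrable (fun p => S.analogScore k V p.1.2 (S.input k p.1 + p.2))
      ((S.sourceLaw J m₀).prod (noiseLaw σ n)) :=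
  integrable_finsetSum _ fun ℓ _ => integrable_uniformScore_analogDec hk J m₀ hS hk₀ hV ℓ

theorem le_integral_analogScore :
    S.L / 2 * Real.log (2 * (k : ℝ) ^ 2 / (Real.pi * Real.exp 1 * V)) ≤
      ∫ p, S.analogScore k V p.1.2 (S.input k p.1 + p.2)
        ∂((S.sourceLaw J m₀).prod (noiseLaw σ n)) := by
  have : (0 : ℝ) < V := by positivity
  have hlog : Real.log (2 * (k : ℝ) ^ 2 / (Real.pi * Real.exp 1 * V)) =
      Real.log (2 * (k : ℝ) ^ 2 / (Real.pi * V)) - 1 := by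
    rw [mul_right_comm, ← div_div, Real.log_div (by positivity) (Real.exp_pos _).ne', Real.log_exp]
  calc _ = ∑ _ℓ : Fin S.L,
        (1 / 2 * Real.log (2 * (k : ℝ) ^ 2 / (Real.pi * V)) - V / (2 * V)) := by
        rw [Finset.sum_const, Finset.card_univ, Fintype.card_fin, nsmul_eq_mul, hlog]
        field_simp
    _ ≤ ∑ ℓ, ∫ p, uniformScore k V (S.analogDec (S.input k p.1 + p.2) ℓ) (p.1.2 ℓ)
        ∂((S.sourceLaw J m₀).prod (noiseLaw σ n)) := by
        refine Finset.sum_le_sum fun ℓ _ => ?_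
        simp only [uniformScore_eq (Nat.cast_pos.2 hk₀) hV]
        rw [integral_sub (integrable_const _)
          ((integrable_sq_sub_analogDec hk J m₀ hS ℓ).div_const _), integral_div, integral_const,
          probReal_univ, one_smul]
        gcongr
        exact integral_sq_sub_analogDec_le hk J m₀ hS ℓ
    _ = _ := (integral_finsetSum _ fun ℓ _ =>
        integrable_uniformScore_analogDec hk J m₀ hS hk₀ hV ℓ).symm

end

end Scores

section SingleBlock

variable {S} {σ Aa : ℝ} (hσ : 0 < σ) {P A : Fin Kd → ℝ} (hS : S.MeetsConstraints Aa P A)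
  (hn : 0 < n) {k : ℕ} (hk : k ≤ Ka) (J : Finset (Fin Kd))

include hσ hS hn hk

theorem measureReal_correctSet_mul_log_add_integral_le (m₀ : (j : Fin Kd) → Fin (S.M j))
    {g : (Fin S.L → Set.Icc (-1 : ℝ) 1) → (Fin n → ℝ) → ℝ} (hg : Measurable (Function.uncurry g))
    (hexp : ∀ y, ∫⁻ θ, ENNReal.ofReal (Real.exp (g θ y)) ∂(Measure.pi fun _ => uniformIcc) ≤ 1)
    (hint : Integrable (fun p => g p.1.2 (S.input k p.1 + p.2))
      ((S.sourceLaw J m₀).prod (noiseLaw σ n))) :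
    ((S.sourceLaw J m₀).prod (noiseLaw σ n)).real (S.correctSet k) *
        Real.log (∏ j ∈ J, (S.M j : ℝ)) +
      ∫ p, g p.1.2 (S.input k p.1 + p.2) ∂((S.sourceLaw J m₀).prod (noiseLaw σ n)) ≤
      Real.log 2 + n * gaussianCapacity ((∑ j ∈ J, P j + k ^ 2 * Aa ^ 2) / σ ^ 2) := by
  have hvar := sum_variance_input_le hS hk J m₀
  have hpower : 0 ≤ ∑ j ∈ J, P j + k ^ 2 * Aa ^ 2 :=
    nonneg_of_mul_nonneg_right ((Finset.sum_nonneg fun _ _ => variance_nonneg _ _).trans hvar)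
      (Nat.cast_pos.2 hn)
  have hdecoding : Integrable (fun p => S.decodingScore J p.1.1 (S.input k p.1 + p.2))
      ((S.sourceLaw J m₀).prod (noiseLaw σ n)) := by
    simp only [decodingScore_input_add]
    exact (integrable_const _).indicator (S.measurableSet_correctSet k)
  have hexp_total (y) : ∫⁻ w, ENNReal.ofReal (Real.exp (S.decodingScore J w.1 y + g w.2 y))
      ∂(S.sourceLaw J m₀) ≤ ENNReal.ofReal 2 := by
    simp only [Real.exp_add, ENNReal.ofReal_mul (Real.exp_pos _).le]
    have hgy : Measurable fun θ => g θ y := hg.comp measurable_prodMk_right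
    rw [sourceLaw, lintegral_prod_mul
      (f := fun m => ENNReal.ofReal (Real.exp (S.decodingScore J m y)))
      (g := fun θ => ENNReal.ofReal (Real.exp (g θ y)))
      Measurable.of_discrete.aemeasurable (by fun_prop), ENNReal.ofReal_ofNat, ← mul_one 2]
    refine mul_le_mul' ?_ (hexp y)
    simpa only [decodingScore, Fintype.card_fin] using
      lintegral_exp_ite_log_card_messageLaw_le J m₀ (S.digitalDec y)
  have hscore := integral_score_le_log_add_gaussianCapacity hσ (S.measurable_input k)
    (memLp_input hS hk J m₀) hpower hvar
    (g := fun w y => S.decodingScore J w.1 y + g w.2 y)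
    (((S.measurable_decodingScore J).comp
      (f := fun p : S.Source × (Fin n → ℝ) => (p.1.1, p.2)) (by fun_prop)).add
      (hg.comp (f := fun p : S.Source × (Fin n → ℝ) => (p.1.2, p.2)) (by fun_prop)))
    two_pos hexp_total (hdecoding.add hint)
  rw [integral_add hdecoding hint] at hscore
  simpa only [decodingScore_input_add, smul_eq_mul,
    integral_indicator_const _ (S.measurableSet_correctSet k)] using hscore

theorem one_sub_mul_sum_log_add_le {V ε : ℝ} (hV : 0 < V) (hε : ∀ s, S.digitalError σ s ≤ ε)
    (hsum : S.ApproximatesSums σ V) :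
    (1 - ε) * ∑ j ∈ J, Real.log (S.M j) +
      S.L / 2 * max (Real.log (2 * (k : ℝ) ^ 2 / (Real.pi * Real.exp 1 * V))) 0 ≤
      Real.log 2 + n * gaussianCapacity ((∑ j ∈ J, P j + k ^ 2 * Aa ^ 2) / σ ^ 2) := by
  obtain ⟨m₀, hm₀⟩ := S.exists_le_measureReal_correctSet hε J k
  lift V to ℝ≥0 using hV.le
  have hV₀ : V ≠ 0 := by exact_mod_cast hV.ne'
  have hdigital : (1 - ε) * ∑ j ∈ J, Real.log (S.M j) ≤
      ((S.sourceLaw J m₀).prod (noiseLaw σ n)).real (S.correctSet k) *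
        Real.log (∏ j ∈ J, (S.M j : ℝ)) := by
    rw [Real.log_prod fun j _ => Nat.cast_ne_zero.2 (m₀ j).pos.ne']
    exact mul_le_mul_of_nonneg_right hm₀ (Finset.sum_nonneg fun j _ => Real.log_natCast_nonneg _)
  rcases le_or_gt (Real.log (2 * (k : ℝ) ^ 2 / (Real.pi * Real.exp 1 * V))) 0 with hℓ | hℓ
  · have hblock := measureReal_correctSet_mul_log_add_integral_le hσ hS hn hk J m₀
      (g := fun _ _ => 0) measurable_const (by simp) (integrable_const _)
    rw [integral_zero] at hblock
    rw [max_eq_right hℓ, mul_zero]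
    linarith
  · have hk₀ : 0 < k := Nat.pos_of_ne_zero fun h => by simp [h] at hℓ
    have hblock := measureReal_correctSet_mul_log_add_integral_le hσ hS hn hk J m₀
      (g := S.analogScore k V) (S.measurable_analogScore (Nat.cast_pos.2 hk₀) hV₀)
      (S.lintegral_exp_analogScore_le (Nat.cast_pos.2 hk₀) hV₀)
      (integrable_analogScore hk J m₀ hsum hk₀ hV₀)
    have hanalog := le_integral_analogScore hk J m₀ hsum hk₀ hV₀
    rw [max_eq_left hℓ.le]
    linarith

end SingleBlock

end SoccScheme

section Converse

variable {Ka Kd : ℕ} {σ Aa : ℝ} {P A : Fin Kd → ℝ} {β V : ℝ}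

theorem isClosed_soccOuter : IsClosed (soccOuter Ka σ Aa P β V) := by
  rw [soccOuter, Set.ofPred_forall]
  exact isClosed_iInter fun J => isClosed_le (by fun_prop) continuous_const

variable (hσ : 0 < σ) (hβ : 0 ≤ β) (hV : 0 < V)

include hσ hβ hV

theorem SoccAchievable.one_sub_mul_sum_add_le {R : Fin Kd → ℝ}
    (hR : SoccAchievable Ka σ Aa P A β V R) (J : Finset (Fin Kd)) {k : ℕ} (hk : k ≤ Ka)
    {ε : ℝ} (hε : 0 < ε) (hε1 : ε ≤ 1) :
    (1 - ε) * ∑ j ∈ J, R j +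
      max (β / 2 * Real.log (2 * (k : ℝ) ^ 2 / (Real.pi * Real.exp 1 * V))) 0 ≤
        gaussianCapacity ((∑ j ∈ J, P j + k ^ 2 * Aa ^ 2) / σ ^ 2) := by
  obtain ⟨-, S, hrate, hL, hcon, herr, happ⟩ := hR
  set C := gaussianCapacity ((∑ j ∈ J, P j + k ^ 2 * Aa ^ 2) / σ ^ 2)
  set ℓ := Real.log (2 * (k : ℝ) ^ 2 / (Real.pi * Real.exp 1 * V))
  have hlim : Tendsto (fun n : ℕ => Real.log 2 / n + C) atTop (𝓝 (0 + C)) :=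
    (tendsto_const_div_atTop_nhds_zero_nat _).add tendsto_const_nhds
  rw [zero_add] at hlim
  refine ge_of_tendsto hlim ?_
  filter_upwards [herr ε hε, happ, eventually_gt_atTop 0] with n hn_err hn_app hn
  have : (0 : ℝ) < n := Nat.cast_pos.2 hn
  have hblock := SoccScheme.one_sub_mul_sum_log_add_le hσ (hcon n hn) hn hk J hV hn_err hn_app
  calc (1 - ε) * ∑ j ∈ J, R j + max (β / 2 * ℓ) 0
      = (1 - ε) * ∑ j ∈ J, R j + β / 2 * max ℓ 0 := by
        rw [mul_max_of_nonneg _ _ (by positivity : 0 ≤ β / 2), mul_zero]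
    _ ≤ (1 - ε) * ∑ j ∈ J, Real.log ((S n).M j) / n + (S n).L / n / 2 * max ℓ 0 := by
        have := sub_nonneg.2 hε1
        gcongr with j
        · exact hrate n hn j
        · exact hL n hn
    _ = ((1 - ε) * ∑ j ∈ J, Real.log ((S n).M j) + (S n).L / 2 * max ℓ 0) / n := by
        rw [← Finset.sum_div]
        ring
    _ ≤ (Real.log 2 + n * C) / n := by gcongr
    _ = Real.log 2 / n + C := by field_simp

theorem SoccAchievable.mem_soccOuter {R : Fin Kd → ℝ} (hR : SoccAchievable Ka σ Aa P A β V R) :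
    R ∈ soccOuter Ka σ Aa P β V := by
  intro J
  rw [Finset.le_inf'_iff]
  intro k hk
  rw [Finset.mem_range, Nat.lt_succ_iff] at hk
  rw [le_sub_iff_add_le]
  have hlim : Tendsto (fun ε : ℝ => (1 - ε) * ∑ j ∈ J, R j +
      max (β / 2 * Real.log (2 * (k : ℝ) ^ 2 / (Real.pi * Real.exp 1 * V))) 0) (𝓝[>] 0)
      (𝓝 (∑ j ∈ J, R j +
        max (β / 2 * Real.log (2 * (k : ℝ) ^ 2 / (Real.pi * Real.exp 1 * V))) 0)) := by
    refine (Continuous.tendsto' (by fun_prop) 0 _ ?_).mono_left nhdsWithin_le_nhds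
    rw [sub_zero, one_mul]
  refine le_of_tendsto hlim ?_
  filter_upwards [Ioc_mem_nhdsGT (zero_lt_one' ℝ)] with ε hε
  exact hR.one_sub_mul_sum_add_le hσ hβ hV J hk hε.1 hε.2

theorem soccCapacity_subset_soccOuter :
    soccCapacity Ka σ Aa P A β V ⊆ soccOuter Ka σ Aa P β V :=
  closure_minimal (fun _ hR => hR.mem_soccOuter hσ hβ hV) isClosed_soccOuter

end Converse

/-! ### Zero-sum isometries with small column sums -/

open scoped Matrix

section HaarMatrix

open Matrix

variable {κ ι κ₁ ι₁ κ₂ ι₂ : Type*} [Fintype κ] [Fintype ι] [DecidableEq κ]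
  [Fintype κ₁] [Fintype ι₁] [DecidableEq κ₁] [Fintype κ₂] [Fintype ι₂] [DecidableEq κ₂]

/-- Matrices sharing the properties of the Haar wavelet basis without its constant function: the
rows are orthonormal and sum to zero, and the absolute values in each column sum to at most `B`. -/
structure IsHaarMatrix (u : Matrix κ ι ℝ) (B : ℝ) : Prop where
  mul_transpose : u * uᵀ = 1
  mulVec_one : u *ᵥ 1 = 0
  sum_abs_le : ∀ i, ∑ j, |u j i| ≤ B

theorem IsHaarMatrix.submatrix {u : Matrix κ ι ℝ} {B : ℝ} (h : IsHaarMatrix u B)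
    (e : κ₁ ≃ κ) (f : ι₁ ≃ ι) : IsHaarMatrix (u.submatrix e f) B where
  mul_transpose := by
    rw [transpose_submatrix, submatrix_mul_equiv, h.mul_transpose, submatrix_one_equiv]
  mulVec_one := by
    rw [submatrix_mulVec_equiv, Pi.one_comp, h.mulVec_one, Pi.zero_comp]
  sum_abs_le i := (e.sum_comp fun j => |u j (f i)|).trans_le (h.sum_abs_le _)

/-- The inductive step of the Haar construction: two matrices are joined by one more row, which is
constant on the columns of each. -/
def haarJoin (u : Matrix κ₁ ι₁ ℝ) (v : Matrix κ₂ ι₂ ℝ) (p q : ℝ) :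
    Matrix ((κ₁ ⊕ κ₂) ⊕ Unit) (ι₁ ⊕ ι₂) ℝ :=
  fromRows (fromBlocks u 0 0 v) (replicateRow Unit (Sum.elim (p • 1) (-(q • 1))))

theorem isHaarMatrix_haarJoin {u : Matrix κ₁ ι₁ ℝ} {v : Matrix κ₂ ι₂ ℝ} {B₁ B₂ B p q : ℝ}
    (hu : IsHaarMatrix u B₁) (hv : IsHaarMatrix v B₂)
    (hsum : Fintype.card ι₁ * p = Fintype.card ι₂ * q)
    (hsq : Fintype.card ι₁ * p ^ 2 + Fintype.card ι₂ * q ^ 2 = 1)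
    (hp : 0 ≤ p) (hq : 0 ≤ q) (hB₁ : B₁ + p ≤ B) (hB₂ : B₂ + q ≤ B) :
    IsHaarMatrix (haarJoin u v p q) B where
  mul_transpose := by
    set D := fromBlocks u 0 0 v with hD
    set w : ι₁ ⊕ ι₂ → ℝ := Sum.elim (p • 1) (-(q • 1)) with hw
    have hDD : D * Dᵀ = 1 := by
      simp [hD, fromBlocks_transpose, fromBlocks_multiply, hu.mul_transpose, hv.mul_transpose]
    have hDw : D *ᵥ w = 0 := by
      simp [hD, hw, fromBlocks_mulVec, mulVec_smul, mulVec_neg, hu.mulVec_one, hv.mulVec_one]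
    have hww : w ⬝ᵥ w = 1 := by
      simpa [hw, dotProduct, sq] using hsq
    have hDW : D * (replicateRow Unit w)ᵀ = 0 := by
      rw [transpose_replicateRow, ← replicateCol_mulVec, hDw, replicateCol_zero]
    have hWD : replicateRow Unit w * Dᵀ = 0 := by
      rw [← transpose_zero, ← hDW, transpose_mul, transpose_transpose]
    have hWW : replicateRow Unit w * (replicateRow Unit w)ᵀ = 1 := by
      ext
      simpa [mul_apply, dotProduct] using hww
    rw [haarJoin, transpose_fromRows, fromRows_mul_fromCols, hDD, hDW, hWD, hWW,
      fromBlocks_one]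
  mulVec_one := by
    have hw : Sum.elim (p • 1) (-(q • 1)) ⬝ᵥ (1 : ι₁ ⊕ ι₂ → ℝ) = 0 := by
      simpa [dotProduct, ← sub_eq_add_neg, sub_eq_zero] using hsum
    ext ((j | j) | j)
    · simpa [haarJoin, fromRows_mulVec, fromBlocks_mulVec] using congr_fun hu.mulVec_one j
    · simpa [haarJoin, fromRows_mulVec, fromBlocks_mulVec] using congr_fun hv.mulVec_one j
    · simpa [haarJoin, fromRows_mulVec, mulVec] using hw
  sum_abs_le := by
    rintro (i | i)
    · simpa [haarJoin, abs_of_nonneg hp] using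
        (add_le_add_left (hu.sum_abs_le i) p).trans hB₁
    · simpa [haarJoin, abs_of_nonneg hq] using
        (add_le_add_left (hv.sum_abs_le i) q).trans hB₂

/-- The bound `(2 + √2) (1 - 1 / √m)` on the column sums of a Haar matrix with `m` columns, chosen
so as to vanish for one column, to stay below `2 + √2` and to survive `haarJoin`. -/
noncomputable def haarBound (m : ℝ) : ℝ :=
  (2 + √2) * (1 - 1 / √m)

theorem haarBound_le (m : ℝ) : haarBound m ≤ 2 + √2 :=
  mul_le_of_le_one_right (by positivity) (sub_le_self _ (by positivity))

theorem haarBound_add_sqrt_le {a b : ℝ} (ha : 0 < a) (hb : 0 < b) (hab : a ≤ 2 * b) :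
    haarBound a + √(b / (a * (a + b))) ≤ haarBound (a + b) := by
  set m := a + b with hm
  have hm0 : 0 < m := add_pos ha hb
  have hsa : √a ^ 2 = a := Real.sq_sqrt ha.le
  have hsb : √b ^ 2 = b := Real.sq_sqrt hb.le
  have hsm : √m ^ 2 = m := Real.sq_sqrt hm0.le
  have hle_a : √a ≤ √2 * √b := by
    rw [← Real.sqrt_mul zero_le_two]
    exact Real.sqrt_le_sqrt hab
  have hle_m : √m ≤ 2 * √b := Real.sqrt_le_left (by positivity) |>.2 (by rw [mul_pow]; linarith)
  have hle_b : √b ≤ (2 + √2) * (√m - √a) := by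
    have hsum : 0 < √m + √a := by positivity
    refine le_of_mul_le_mul_right ?_ hsum
    calc √b * (√m + √a) ≤ √b * ((2 + √2) * √b) := by gcongr; linarith
      _ = (2 + √2) * (√m - √a) * (√m + √a) := by
        linear_combination (2 + √2) * (hsb + hsa - hsm + hm)
  have hinc : haarBound m - haarBound a = (2 + √2) * (√m - √a) / (√a * √m) := by
    unfold haarBound
    field_simp
    ring
  calc haarBound a + √(b / (a * m)) = haarBound a + √b / (√a * √m) := by
        rw [Real.sqrt_div hb.le, Real.sqrt_mul ha.le]
    _ ≤ haarBound a + (2 + √2) * (√m - √a) / (√a * √m) := by gcongr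
    _ = haarBound m := by rw [← hinc, add_sub_cancel]

theorem exists_isHaarMatrix_add {a b : ℕ} {u : Matrix (Fin (a - 1)) (Fin a) ℝ}
    {v : Matrix (Fin (b - 1)) (Fin b) ℝ} (ha : 0 < a) (hb : 0 < b) (hab : a ≤ 2 * b)
    (hba : b ≤ 2 * a) (hu : IsHaarMatrix u (haarBound a)) (hv : IsHaarMatrix v (haarBound b)) :
    ∃ w : Matrix (Fin (a + b - 1)) (Fin (a + b)) ℝ,
      IsHaarMatrix w (haarBound (a + b : ℕ)) := by
  have ha' : (0 : ℝ) < a := by exact_mod_cast ha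
  have hb' : (0 : ℝ) < b := by exact_mod_cast hb
  have key := isHaarMatrix_haarJoin hu hv
    (p := √((b : ℝ) / (a * (a + b)))) (q := √((a : ℝ) / (b * (b + a))))
    (B := haarBound (a + b : ℕ)) ?_ ?_ (by positivity) (by positivity) ?_ ?_
  · exact ⟨_, key.submatrix (Fintype.equivOfCardEq (by
      simp only [Fintype.card_sum, Fintype.card_fin, Fintype.card_unit]; omega))
      (Fintype.equivOfCardEq (by simp))⟩
  · rw [Fintype.card_fin, Fintype.card_fin, Real.sqrt_div hb'.le, Real.sqrt_div ha'.le,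
      Real.sqrt_mul ha'.le, Real.sqrt_mul hb'.le, add_comm (b : ℝ)]
    field_simp
    rw [Real.sq_sqrt ha'.le, Real.sq_sqrt hb'.le]
  · rw [Fintype.card_fin, Fintype.card_fin, Real.sq_sqrt (by positivity),
      Real.sq_sqrt (by positivity)]
    field_simp
    ring
  · exact_mod_cast haarBound_add_sqrt_le ha' hb' (by exact_mod_cast hab)
  · rw [add_comm a b]
    exact_mod_cast haarBound_add_sqrt_le hb' ha' (by exact_mod_cast hba)

theorem exists_isHaarMatrix (N : ℕ) (hN : 0 < N) :
    ∃ u : Matrix (Fin (N - 1)) (Fin N) ℝ, IsHaarMatrix u (haarBound N) := by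
  induction N using Nat.strong_induction_on with
  | _ N ih =>
    rcases Nat.lt_or_ge N 2 with h | h
    · obtain rfl : N = 1 := by omega
      exact ⟨0, Matrix.ext fun j => j.elim0, funext fun j => j.elim0, by simp [haarBound]⟩
    · obtain ⟨a, b, rfl, ha, hb, hab, hba⟩ :
          ∃ a b, N = a + b ∧ 0 < a ∧ 0 < b ∧ a ≤ 2 * b ∧ b ≤ 2 * a :=
        ⟨N - N / 2, N / 2, by omega, by omega, by omega, by omega, by omega⟩
      obtain ⟨u, hu⟩ := ih a (by omega) ha
      obtain ⟨v, hv⟩ := ih b (by omega) hb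
      exact exists_isHaarMatrix_add ha hb hab hba hu hv

variable {μ μ' ι' : Type*} [Fintype μ] [DecidableEq μ] [Fintype μ'] [DecidableEq μ'] [Fintype ι']

/-- Two orthogonal sets of subchannels of the Gaussian channel: the rows of `B` (for analog values)
are orthogonal of squared norm `N`, those of `U` (for digital codewords) are orthonormal. The
column sums bound the peak amplitudes of the inputs `s ᵥ* B` and `x ᵥ* U`. -/
structure IsSubchannelPair (B : Matrix κ ι ℝ) (U : Matrix μ ι ℝ) (N c : ℝ) : Prop where
  analog_mul_transpose : B * Bᵀ = N • 1
  digital_mul_transpose : U * Uᵀ = 1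
  digital_mul_analog_transpose : U * Bᵀ = 0
  sum_abs_analog_le : ∀ i, ∑ j, |B j i| ≤ 1
  sum_abs_digital_le : ∀ i, ∑ j, |U j i| ≤ c

theorem IsSubchannelPair.submatrix {B : Matrix κ ι ℝ} {U : Matrix μ ι ℝ} {N c : ℝ}
    (h : IsSubchannelPair B U N c) (e : μ' ≃ μ) (f : ι' ≃ ι) :
    IsSubchannelPair (B.submatrix id f) (U.submatrix e f) N c where
  analog_mul_transpose := by
    rw [transpose_submatrix, submatrix_mul_equiv, h.analog_mul_transpose, submatrix_id_id]
  digital_mul_transpose := by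
    rw [transpose_submatrix, submatrix_mul_equiv, h.digital_mul_transpose, submatrix_one_equiv]
  digital_mul_analog_transpose := by
    rw [transpose_submatrix, submatrix_mul_equiv, h.digital_mul_analog_transpose, submatrix_zero,
      Pi.zero_apply, Pi.zero_apply]
  sum_abs_analog_le i := h.sum_abs_analog_le (f i)
  sum_abs_digital_le i := (e.sum_comp fun j => |U j (f i)|).trans_le (h.sum_abs_digital_le _)

/-- Each row is the indicator function of one of `o` blocks of columns indexed by `ι`; the columns
in `ρ` belong to no block. -/
def blockIndicator (o ι ρ : Type*) [DecidableEq o] : Matrix o ((ι × o) ⊕ ρ) ℝ :=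
  fromCols (of fun a x => if a = x.2 then 1 else 0) 0

/-- The rows of `u` on each of `o` blocks of columns, together with the unit vectors of the columns
in `ρ`. -/
def blockHaar (o ρ : Type*) [DecidableEq o] [DecidableEq ρ] (u : Matrix κ ι ℝ) :
    Matrix ((κ × o) ⊕ ρ) ((ι × o) ⊕ ρ) ℝ :=
  fromBlocks (blockDiagonal fun _ => u) 0 0 1

theorem isSubchannelPair_blocks (o ρ : Type*) [Fintype o] [DecidableEq o] [Fintype ρ]
    [DecidableEq ρ] {u : Matrix κ ι ℝ} {c : ℝ} (hu : IsHaarMatrix u c) (hc : 1 ≤ c) :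
    IsSubchannelPair (blockIndicator o ι ρ) (blockHaar o ρ u) (Fintype.card ι) c where
  analog_mul_transpose := by
    ext a b
    by_cases hab : a = b <;>
      simp [blockIndicator, mul_apply, Fintype.sum_prod_type, one_apply, hab]
  digital_mul_transpose := by
    have hdiag : blockDiagonal (fun _ : o => u) * blockDiagonal (fun _ : o => uᵀ) = 1 := by
      rw [← blockDiagonal_mul, hu.mul_transpose]
      exact blockDiagonal_one
    simp [blockHaar, fromBlocks_transpose, fromBlocks_multiply, blockDiagonal_transpose, hdiag]
  digital_mul_analog_transpose := by
    have hsum (j : κ) : ∑ i, u j i = 0 := by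
      simpa [mulVec, dotProduct] using congr_fun hu.mulVec_one j
    ext (⟨j, b⟩ | j) a
    · simp [blockHaar, blockIndicator, mul_apply, Fintype.sum_prod_type, blockDiagonal_apply, hsum]
    · simp [blockHaar, blockIndicator, mul_apply]
  sum_abs_analog_le := by
    rintro (⟨i, a⟩ | i) <;> simp [blockIndicator, apply_ite abs]
  sum_abs_digital_le := by
    rintro (⟨i, a⟩ | i)
    · simpa [blockHaar, blockDiagonal_apply, Fintype.sum_prod_type, apply_ite abs] using
        hu.sum_abs_le i
    · simpa [blockHaar, one_apply, apply_ite abs] using hc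

theorem exists_isSubchannelPair {n q N : ℕ} (hN : 0 < N) (hq : q * N ≤ n) :
    ∃ (B : Matrix (Fin q) (Fin n) ℝ) (U : Matrix (Fin (n - q)) (Fin n) ℝ),
      IsSubchannelPair B U N (2 + √2) := by
  obtain ⟨u, hu⟩ := exists_isHaarMatrix N hN
  have hc : IsHaarMatrix u (2 + √2) :=
    { hu with sum_abs_le := fun i => (hu.sum_abs_le i).trans (haarBound_le N) }
  have hqN : q ≤ q * N := Nat.le_mul_of_pos_right q hN
  have hrows : Fintype.card (Fin (n - q)) =
      Fintype.card ((Fin (N - 1) × Fin q) ⊕ Fin (n - q * N)) := by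
    simp only [Fintype.card_sum, Fintype.card_prod, Fintype.card_fin, Nat.sub_mul, mul_comm N]
    omega
  have hcols : Fintype.card (Fin n) = Fintype.card ((Fin N × Fin q) ⊕ Fin (n - q * N)) := by
    simp only [Fintype.card_sum, Fintype.card_prod, Fintype.card_fin, mul_comm N]
    omega
  have h := (isSubchannelPair_blocks (Fin q) (Fin (n - q * N)) hc (by
    linarith [Real.sqrt_nonneg 2])).submatrix
    (Fintype.equivOfCardEq hrows) (Fintype.equivOfCardEq hcols)
  rw [Fintype.card_fin] at h
  exact ⟨_, _, h⟩

end HaarMatrix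

/-! ### White Gaussian noise under isometries -/

section NoiseProjection

open Matrix

variable (σ : ℝ) {n : ℕ}

theorem integral_noiseLaw_dotProduct (a : Fin n → ℝ) : ∫ z, a ⬝ᵥ z ∂(noiseLaw σ n) = 0 := by
  have hint : ∀ i ∈ Finset.univ, Integrable (fun z => a i * z i) (noiseLaw σ n) := fun i _ =>
    ((memLp_noiseLaw_eval σ i).integrable one_le_two).const_mul _
  simp only [dotProduct, integral_finsetSum _ hint, integral_const_mul, integral_noiseLaw_eval,
    mul_zero, Finset.sum_const_zero]

theorem variance_noiseLaw_dotProduct (a : Fin n → ℝ) :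
    Var[fun z => a ⬝ᵥ z; noiseLaw σ n] = σ ^ 2 * (a ⬝ᵥ a) := by
  have hsum : (fun z : Fin n → ℝ => a ⬝ᵥ z) = ∑ i, fun z => a i * id (z i) := by
    ext
    simp only [dotProduct, Finset.sum_apply, id]
  rw [hsum, noiseLaw, variance_sum_pi fun i => (memLp_id_gaussianReal 2).const_mul (a i)]
  simp only [variance_const_mul, variance_id_gaussianReal, Real.coe_toNNReal _ (sq_nonneg σ),
    ← Finset.sum_mul, dotProduct, ← sq, mul_comm (σ ^ 2)]

instance isGaussian_noiseLaw (n : ℕ) : IsGaussian (noiseLaw σ n) := by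
  have hlaw : HasGaussianLaw (fun (z : Fin n → ℝ) i => z i) (noiseLaw σ n) :=
    iIndepFun.hasGaussianLaw
      (fun i => (measurePreserving_noiseLaw_eval σ i).hasLaw.hasGaussianLaw)
      (iIndepFun_pi (X := fun _ => id) fun _ => aemeasurable_id)
  simpa using hlaw.isGaussian_map

theorem lintegral_noiseLaw_const_mul_dotProduct_sq (b : ℝ) (a : Fin n → ℝ) :
    ∫⁻ z, ENNReal.ofReal ((b * (a ⬝ᵥ z)) ^ 2) ∂(noiseLaw σ n) =
      ENNReal.ofReal (b ^ 2 * (σ ^ 2 * (a ⬝ᵥ a))) := by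
  have hmem : MemLp (fun z => b * (a ⬝ᵥ z)) 2 (noiseLaw σ n) :=
    (memLp_finsetSum _ fun i _ => (memLp_noiseLaw_eval σ i).const_mul (a i)).const_mul b
  have hmean : ∫ z, b * (a ⬝ᵥ z) ∂(noiseLaw σ n) = 0 := by
    rw [integral_const_mul, integral_noiseLaw_dotProduct, mul_zero]
  rw [← ofReal_integral_eq_lintegral_ofReal hmem.integrable_sq (ae_of_all _ fun z => sq_nonneg _),
    ← variance_of_integral_eq_zero hmem.aemeasurable hmean, variance_const_mul,
    variance_noiseLaw_dotProduct]

theorem charFunDual_noiseLaw {L : StrongDual ℝ (Fin n → ℝ)} {a : Fin n → ℝ}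
    (hL : ∀ z, L z = a ⬝ᵥ z) :
    charFunDual (noiseLaw σ n) L = Complex.exp (-(σ ^ 2 * (a ⬝ᵥ a) : ℝ) / 2) := by
  have hL' : ⇑L = fun z => a ⬝ᵥ z := funext hL
  rw [IsGaussian.charFunDual_eq, integral_complex_ofReal, hL', integral_noiseLaw_dotProduct,
    variance_noiseLaw_dotProduct, Complex.ofReal_zero, zero_mul, zero_sub, neg_div]

theorem vecMul_dotProduct_vecMul {R κ ι : Type*} [CommSemiring R] [Fintype κ] [Fintype ι]
    [DecidableEq κ] {U : Matrix κ ι R} (hU : U * Uᵀ = 1) (x : κ → R) :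
    x ᵥ* U ⬝ᵥ x ᵥ* U = x ⬝ᵥ x := by
  rw [← dotProduct_mulVec, ← mulVec_transpose, mulVec_mulVec, hU, one_mulVec]

theorem noiseLaw_map_mulVec {m : ℕ} {U : Matrix (Fin m) (Fin n) ℝ} (hU : U * Uᵀ = 1) :
    (noiseLaw σ n).map (U *ᵥ ·) = noiseLaw σ m := by
  let T : (Fin n → ℝ) →L[ℝ] (Fin m → ℝ) := U.mulVecLin.toContinuousLinearMap
  change (noiseLaw σ n).map T = noiseLaw σ m
  refine Measure.ext_of_charFunDual (funext fun L => ?_)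
  obtain ⟨a, ha⟩ := (dotProductEquiv ℝ (Fin m)).surjective L.toLinearMap
  have hL : ∀ z, L z = a ⬝ᵥ z := fun z => (LinearMap.congr_fun ha z).symm
  have hLT : ∀ z, L.comp T z = a ᵥ* U ⬝ᵥ z := fun z =>
    (hL _).trans (dotProduct_mulVec a U z)
  rw [charFunDual_map, charFunDual_noiseLaw σ hLT, charFunDual_noiseLaw σ hL,
    vecMul_dotProduct_vecMul hU]

end NoiseProjection

/-! ### Superposition of analog transmission and a code -/

section Superposition

open Matrix

theorem abs_vecMul_apply_le {κ ι : Type*} [Fintype κ] {M : Matrix κ ι ℝ} {x : κ → ℝ} {a c : ℝ}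
    {i : ι} (ha : 0 ≤ a) (hx : ∀ j, |x j| ≤ a) (hM : ∑ j, |M j i| ≤ c) :
    |(x ᵥ* M) i| ≤ a * c :=
  calc |(x ᵥ* M) i| ≤ ∑ j, |x j * M j i| := Finset.abs_sum_le_sum_abs _ _
    _ ≤ ∑ j, a * |M j i| := Finset.sum_le_sum fun j _ => by
        rw [abs_mul]
        exact mul_le_mul_of_nonneg_right (hx j) (abs_nonneg _)
    _ ≤ a * c := by
        rw [← Finset.mul_sum]
        exact mul_le_mul_of_nonneg_left hM ha

namespace IsSubchannelPair

variable {κ ι μ : Type*} [Fintype κ] [DecidableEq κ] [Fintype ι] [Fintype μ] [DecidableEq μ]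
  {B : Matrix κ ι ℝ} {U : Matrix μ ι ℝ} {N c : ℝ}

theorem digital_mulVec_add (h : IsSubchannelPair B U N c) (a : κ → ℝ) (x : μ → ℝ) :
    U *ᵥ (a ᵥ* B + x ᵥ* U) = x := by
  rw [← mulVec_transpose, ← mulVec_transpose, mulVec_add, mulVec_mulVec, mulVec_mulVec,
    h.digital_mul_analog_transpose, h.digital_mul_transpose, zero_mulVec, one_mulVec, zero_add]

theorem analog_mulVec_add (h : IsSubchannelPair B U N c) (a : κ → ℝ) (x : μ → ℝ) :
    B *ᵥ (a ᵥ* B + x ᵥ* U) = N • a := by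
  have hBU : B * Uᵀ = 0 := by
    rw [← transpose_zero, ← h.digital_mul_analog_transpose, transpose_mul, transpose_transpose]
  rw [← mulVec_transpose, ← mulVec_transpose, mulVec_add, mulVec_mulVec, mulVec_mulVec,
    h.analog_mul_transpose, hBU, zero_mulVec, smul_mulVec, one_mulVec, add_zero]

theorem analog_dotProduct_self (h : IsSubchannelPair B U N c) (j : κ) : B j ⬝ᵥ B j = N := by
  simpa [mul_apply, dotProduct] using congr_fun₂ h.analog_mul_transpose j j

end IsSubchannelPair

theorem measurable_mulVec {κ ι : Type*} [Fintype ι] (M : Matrix κ ι ℝ) :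
    Measurable fun x : ι → ℝ => M *ᵥ x :=
  measurable_pi_lambda _ fun _ => (continuous_const.dotProduct continuous_id).measurable

/-- Analog values are sent at full amplitude on the rows of `B`, the codewords of `c` on the rows
of `U`; the receiver projects the channel output on the rows of both matrices. -/
noncomputable abbrev superposition {Kd n q m : ℕ} (Ka : ℕ) (Aa N : ℝ)
    (B : Matrix (Fin q) (Fin n) ℝ) (U : Matrix (Fin m) (Fin n) ℝ) (c : MacCode Kd m) :
    SoccScheme Ka Kd n where
  L := q
  M := c.M
  analogEnc _ s := (Aa • fun ℓ => (s ℓ : ℝ)) ᵥ* B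
  measurable_analogEnc _ := Continuous.measurable (by fun_prop)
  digitalEnc k x := c.enc k x ᵥ* U
  digitalDec y := c.dec (U *ᵥ y)
  measurable_digitalDec := c.measurable_dec.comp (measurable_mulVec U)
  analogDec y := (N * Aa)⁻¹ • (B *ᵥ y)
  measurable_analogDec := (measurable_mulVec B).const_smul (N * Aa)⁻¹

variable {Ka Kd n q m : ℕ} {Aa N : ℝ} {B : Matrix (Fin q) (Fin n) ℝ}
  {U : Matrix (Fin m) (Fin n) ℝ} {c : MacCode Kd m} {γ : ℝ}
  (h : IsSubchannelPair B U N γ)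

theorem superposition_outputLaw (σ : ℝ) (s : Fin Ka → Fin q → Set.Icc (-1 : ℝ) 1)
    (w : (k : Fin Kd) → Fin (c.M k)) :
    (superposition Ka Aa N B U c).outputLaw σ s w = (noiseLaw σ n).map fun z =>
      (∑ k, Aa • fun ℓ => (s k ℓ : ℝ)) ᵥ* B + (∑ k, c.enc k (w k)) ᵥ* U + z := by
  simp only [SoccScheme.outputLaw, macOutputLaw, Fintype.sum_sum_type,
    Sum.elim_inl, Sum.elim_inr, sum_vecMul]

include h

theorem superposition_digitalError (σ : ℝ) (s : Fin Ka → Fin q → Set.Icc (-1 : ℝ) 1) :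
    (superposition Ka Aa N B U c).digitalError σ s = c.error σ := by
  unfold SoccScheme.digitalError MacCode.error
  congr 1
  refine Finset.sum_congr rfl fun w _ => ?_
  have hms : MeasurableSet {y | c.dec y ≠ w} :=
    (c.measurable_dec (measurableSet_singleton w)).compl
  change Measure.real _ ((U *ᵥ ·) ⁻¹' {y | c.dec y ≠ w}) = _
  rw [superposition_outputLaw, macOutputLaw, ← map_measureReal_apply (measurable_mulVec U) hms,
    Measure.map_map (measurable_mulVec U) (by fun_prop),
    ← noiseLaw_map_mulVec σ h.digital_mul_transpose,
    Measure.map_map (by fun_prop) (measurable_mulVec U)]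
  congr 2
  ext1 z
  simp only [Function.comp_apply, mulVec_add U _ z, h.digital_mulVec_add]

theorem superposition_meetsConstraints (hγ : 0 < γ) (hn : 0 < n) (hAa : 0 ≤ Aa)
    {P A : Fin Kd → ℝ} (hA : ∀ k, 0 ≤ A k) (hcA : ∀ k w j, |c.enc k w j| ≤ A k / γ)
    (hcP : ∀ k w, ∑ j, c.enc k w j ^ 2 ≤ n * P k) :
    (superposition Ka Aa N B U c).MeetsConstraints Aa P A := by
  refine ⟨fun k s => (pi_norm_le_iff_of_nonneg hAa).2 fun i => ?_, fun k w =>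
    ⟨(pi_norm_le_iff_of_nonneg (hA k)).2 fun i => ?_, ?_⟩⟩
  · have hs (ℓ : Fin q) : |(Aa • fun ℓ => (s ℓ : ℝ)) ℓ| ≤ Aa := by
      rw [Pi.smul_apply, smul_eq_mul, abs_mul, abs_of_nonneg hAa]
      exact mul_le_of_le_one_right hAa (abs_le.2 (s ℓ).2)
    exact (abs_vecMul_apply_le hAa hs (h.sum_abs_analog_le i)).trans_eq (mul_one Aa)
  · exact (abs_vecMul_apply_le (div_nonneg (hA k) hγ.le) (hcA k w)
      (h.sum_abs_digital_le i)).trans_eq (div_mul_cancel₀ _ hγ.ne')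
  · have hsq : ∑ i, (c.enc k w ᵥ* U) i ^ 2 = ∑ j, c.enc k w j ^ 2 := by
      simpa only [dotProduct, ← sq] using
        vecMul_dotProduct_vecMul h.digital_mul_transpose (c.enc k w)
    rw [PowerBounded, one_div, inv_mul_le_iff₀ (by positivity)]
    exact hsq.trans_le (hcP k w)

theorem superposition_estimate_error (hN : N ≠ 0) (hAa : Aa ≠ 0)
    (s : Fin Ka → Fin q → Set.Icc (-1 : ℝ) 1) (x : Fin m → ℝ) (z : Fin n → ℝ) (ℓ : Fin q) :
    ∑ k, (s k ℓ : ℝ) - (superposition Ka Aa N B U c).analogDec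
      ((∑ k, Aa • fun ℓ => (s k ℓ : ℝ)) ᵥ* B + x ᵥ* U + z) ℓ = -(N * Aa)⁻¹ * (B ℓ ⬝ᵥ z) := by
  have hz : (B *ᵥ z) ℓ = B ℓ ⬝ᵥ z := rfl
  simp only [mulVec_add B _ z, h.analog_mulVec_add, Pi.smul_apply, Pi.add_apply,
    Finset.sum_apply, smul_eq_mul, ← Finset.mul_sum, hz]
  field_simp
  ring

theorem superposition_approximatesSums (hN : 0 < N) (hAa : 0 < Aa) (σ : ℝ) :
    (superposition Ka Aa N B U c).ApproximatesSums σ (1 / N * σ ^ 2 / Aa ^ 2) := by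
  intro (ℓ : Fin q) s w
  have hmeas : Measurable fun y => (superposition Ka Aa N B U c).analogDec y ℓ :=
    (measurable_pi_apply ℓ).comp (superposition Ka Aa N B U c).measurable_analogDec
  rw [superposition_outputLaw,
    lintegral_map ((hmeas.const_sub _).pow_const 2).ennreal_ofReal (by fun_prop)]
  refine le_of_eq ?_
  calc _ = ∫⁻ z, ENNReal.ofReal ((-(N * Aa)⁻¹ * (B ℓ ⬝ᵥ z)) ^ 2) ∂(noiseLaw σ n) :=
        lintegral_congr fun z => by rw [superposition_estimate_error h hN.ne' hAa.ne']
    _ = ENNReal.ofReal (1 / N * σ ^ 2 / Aa ^ 2) := by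
        rw [lintegral_noiseLaw_const_mul_dotProduct_sq, h.analog_dotProduct_self]
        congr 1
        field_simp

end Superposition

/-! ### Achievability -/

/-- The scheme in which nobody transmits; it fills in block lengths that do not matter. -/
noncomputable def silentScheme (Ka Kd n : ℕ) (M : Fin Kd → ℕ) (hM : ∀ k, 0 < M k) :
    SoccScheme Ka Kd n where
  L := n
  M := M
  analogEnc _ _ := 0
  measurable_analogEnc _ := measurable_const
  digitalEnc _ _ := 0
  digitalDec _ k := ⟨0, hM k⟩
  measurable_digitalDec := measurable_const
  analogDec _ _ := 0
  measurable_analogDec := measurable_const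

/-- The code with a single message for each transmitter. -/
def trivialCode (K n : ℕ) : MacCode K n where
  M _ := 1
  enc _ _ := 0
  dec _ _ := 0
  measurable_dec := measurable_const

theorem trivialCode_error (K n : ℕ) (σ : ℝ) : (trivialCode K n).error σ = 0 := by
  have hempty (w : (k : Fin K) → Fin ((trivialCode K n).M k)) :
      {y | (trivialCode K n).dec y ≠ w} = ∅ :=
    Set.eq_empty_of_forall_notMem fun y hy =>
      hy (funext fun k => Subsingleton.elim (α := Fin 1) _ _)
  simp only [MacCode.error, hempty, measureReal_empty, Finset.sum_const_zero, mul_zero]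

theorem amplitudeBounded_zero {n : ℕ} {a : ℝ} (ha : 0 ≤ a) :
    AmplitudeBounded a (0 : Fin n → ℝ) := by
  rwa [AmplitudeBounded, norm_zero]

theorem powerBounded_zero {n : ℕ} {p : ℝ} (hp : 0 ≤ p) : PowerBounded p (0 : Fin n → ℝ) := by
  simpa [PowerBounded] using hp

theorem one_sub_one_div_mul_le_sub_div (n N : ℕ) :
    (1 - 1 / (N : ℝ)) * n ≤ ((n - n / N : ℕ) : ℝ) := by
  have hdiv : ((n / N : ℕ) : ℝ) ≤ n / N := Nat.cast_div_le
  calc (1 - 1 / (N : ℝ)) * n = n - n / N := by ring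
    _ ≤ n - (n / N : ℕ) := sub_le_sub_left hdiv _
    _ = ((n - n / N : ℕ) : ℝ) := (Nat.cast_sub (Nat.div_le_self n N)).symm

theorem MacAchievable.exists_codes_sub_div {K : ℕ} {σ : ℝ} {P A R : Fin K → ℝ}
    (hR : MacAchievable σ P A R) (hP : ∀ k, 0 ≤ P k) (hA : ∀ k, 0 ≤ A k) {N : ℕ} (hN : 0 < N) :
    ∃ c : (n : ℕ) → MacCode K (n - n / N),
      (∀ n, 0 < n → ∀ k, (1 - 1 / N) * R k ≤ Real.log ((c n).M k) / n) ∧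
      (∀ n, 0 < n → ∀ k w,
        PowerBounded (P k) ((c n).enc k w) ∧ AmplitudeBounded (A k) ((c n).enc k w)) ∧
      Tendsto (fun n => (c n).error σ) atTop (𝓝 0) := by
  obtain ⟨hR0, c, hrate, hcon, herr⟩ := hR
  rcases (Nat.succ_le_of_lt hN).eq_or_lt with rfl | hN
  · refine ⟨fun n => trivialCode K _, fun n _ k => ?_, fun n _ k w =>
      ⟨powerBounded_zero (hP k), amplitudeBounded_zero (hA k)⟩, ?_⟩
    · simp [trivialCode]
    · simp only [trivialCode_error, tendsto_const_nhds]
  have hlt (n : ℕ) (hn : 0 < n) : 0 < n - n / N := Nat.sub_pos_of_lt (Nat.div_lt_self hn hN)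
  refine ⟨fun n => c (n - n / N), fun n hn k => ?_, fun n hn => hcon _ (hlt n hn),
    herr.comp (tendsto_atTop_mono (f := fun n => n / 2) (fun n => ?_)
      (Nat.tendsto_div_const_atTop two_ne_zero))⟩
  · have hrate := hrate _ (hlt n hn) k
    rw [le_div_iff₀ (by exact_mod_cast hlt n hn)] at hrate
    rw [le_div_iff₀ (by exact_mod_cast hn)]
    calc (1 - 1 / (N : ℝ)) * R k * n = R k * ((1 - 1 / N) * n) := by ring
      _ ≤ R k * (n - n / N : ℕ) :=
          mul_le_mul_of_nonneg_left (one_sub_one_div_mul_le_sub_div n N) (hR0 k)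
      _ ≤ Real.log ((c (n - n / N)).M k) := hrate
  · have : n / N ≤ n / 2 := Nat.div_le_div_left hN two_pos
    omega

theorem eventually_le_natDiv_div {β : ℝ} {N : ℕ} (hβ : β < 1 / N) :
    ∀ᶠ n : ℕ in atTop, β ≤ ((n / N : ℕ) : ℝ) / n := by
  have hlim : Tendsto (fun n : ℕ => (⌊(1 / N : ℝ) * n⌋₊ : ℝ) / n) atTop (𝓝 (1 / N)) :=
    (tendsto_nat_floor_mul_div_atTop (by positivity)).comp tendsto_natCast_atTop_atTop
  filter_upwards [hlim.eventually_const_le hβ] with n hn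
  rwa [one_div_mul_eq_div, Nat.floor_div_eq_div] at hn

theorem sqrt_two_div_sqrt_two_sub_one : √2 / (√2 - 1) = 2 + √2 := by
  have hne : √2 - 1 ≠ 0 := (sub_pos.2 Real.one_lt_sqrt_two).ne'
  rw [div_eq_iff hne]
  linear_combination -Real.mul_self_sqrt zero_le_two

section Achievability

variable {Ka Kd : ℕ} {σ Aa β V : ℝ} {P A R : Fin Kd → ℝ}

theorem soccAchievable_of_eventually (hAa : 0 ≤ Aa) (hP : ∀ k, 0 ≤ P k) (hA : ∀ k, 0 ≤ A k)
    (hβ : β ≤ 1) (hR : ∀ k, 0 ≤ R k) (S : (n : ℕ) → SoccScheme Ka Kd n)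
    (hrate : ∀ᶠ n in atTop, ∀ k, R k ≤ Real.log ((S n).M k) / n)
    (hanalog : ∀ᶠ n in atTop, β ≤ ((S n).L : ℝ) / n)
    (hcon : ∀ᶠ n in atTop, (S n).MeetsConstraints Aa P A)
    (herr : ∀ ε > 0, ∀ᶠ n in atTop, ∀ s, (S n).digitalError σ s ≤ ε)
    (happrox : ∀ᶠ n in atTop, (S n).ApproximatesSums σ V) :
    SoccAchievable Ka σ Aa P A β V R := by
  classical
  let valid (n : ℕ) : Prop := (∀ k, R k ≤ Real.log ((S n).M k) / n) ∧
    β ≤ ((S n).L : ℝ) / n ∧ (S n).MeetsConstraints Aa P A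
  have hM (n : ℕ) (k : Fin Kd) : 0 < ⌈Real.exp (R k * n)⌉₊ := Nat.ceil_pos.2 (Real.exp_pos _)
  let S' (n : ℕ) : SoccScheme Ka Kd n := if valid n then S n else silentScheme Ka Kd n _ (hM n)
  have hS' : ∀ᶠ n in atTop, S' n = S n := by
    filter_upwards [hrate, hanalog, hcon] with n h₁ h₂ h₃ using if_pos ⟨h₁, h₂, h₃⟩
  have hvalid (n : ℕ) (hn : 0 < n) : (∀ k, R k ≤ Real.log ((S' n).M k) / n) ∧
      β ≤ ((S' n).L : ℝ) / n ∧ (S' n).MeetsConstraints Aa P A := by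
    have hn' : (0 : ℝ) < n := by exact_mod_cast hn
    by_cases h : valid n
    · simpa only [S', if_pos h] using h
    · simp only [S', if_neg h]
      refine ⟨fun k => ?_, ?_, fun _ _ => amplitudeBounded_zero hAa,
        fun k w => ⟨amplitudeBounded_zero (hA k), powerBounded_zero (hP k)⟩⟩
      · rw [le_div_iff₀ hn', Real.le_log_iff_exp_le (by exact_mod_cast hM n k)]
        exact Nat.le_ceil _
      · exact hβ.trans_eq (div_self hn'.ne').symm
  refine ⟨hR, S', fun n hn => (hvalid n hn).1, fun n hn => (hvalid n hn).2.1,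
    fun n hn => (hvalid n hn).2.2, fun ε hε => ?_, ?_⟩
  · filter_upwards [hS', herr ε hε] with n h using h ▸ id
  · filter_upwards [hS', happrox] with n h using h ▸ id

variable {N : ℕ}

theorem MacAchievable.soccAchievable
    (hR : MacAchievable σ (fun k => P k / (1 - β)) (fun k => A k / (√2 / (√2 - 1))) R)
    (Ka : ℕ) (hAa : 0 < Aa) (hP : ∀ k, 0 ≤ P k) (hA : ∀ k, 0 ≤ A k)
    (hN : 0 < N) (hβ : β < 1 / N) :
    SoccAchievable Ka σ Aa P A β (1 / N * σ ^ 2 / Aa ^ 2) fun k => (1 - 1 / N) * R k := by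
  have hN1 : (1 : ℝ) / N ≤ 1 := by
    rw [one_div]
    exact Nat.cast_inv_le_one N
  have hβ1 : 0 < 1 - β := by linarith
  rw [sqrt_two_div_sqrt_two_sub_one] at hR
  obtain ⟨c, hrate, hcon, herr⟩ := hR.exists_codes_sub_div
    (fun k => div_nonneg (hP k) hβ1.le) (fun k => div_nonneg (hA k) (by positivity)) hN
  choose B U hBU using fun n : ℕ =>
    exists_isSubchannelPair (n := n) hN (Nat.div_mul_le_self n N)
  have hpos : ∀ᶠ n : ℕ in atTop, 0 < n := eventually_gt_atTop 0
  refine soccAchievable_of_eventually hAa.le hP hA (by linarith)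
    (fun k => mul_nonneg (by linarith) (hR.1 k))
    (fun n => superposition Ka Aa N (B n) (U n) (c n)) (hpos.mono hrate)
    (eventually_le_natDiv_div hβ) ?_ (fun ε hε => ?_) (Eventually.of_forall fun n =>
      superposition_approximatesSums (hBU n) (by exact_mod_cast hN) hAa σ)
  · filter_upwards [hpos, eventually_le_natDiv_div hβ] with n hn hdiv
    rw [le_div_iff₀ (by exact_mod_cast hn)] at hdiv
    refine superposition_meetsConstraints (hBU n) (by positivity) hn hAa.le hA
      (fun k w => (hcon n hn k w).2.abs_apply_le)
      (fun k w => (hcon n hn k w).1.sum_sq_le.trans ?_)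
    rw [Nat.cast_sub (Nat.div_le_self n N), mul_div_assoc', div_le_iff₀ hβ1]
    calc (n - (n / N : ℕ)) * P k ≤ (n - β * n) * P k :=
          mul_le_mul_of_nonneg_right (sub_le_sub_left hdiv _) (hP k)
      _ = n * P k * (1 - β) := by ring
  · filter_upwards [herr.eventually_le_const hε] with n hn s
    exact (superposition_digitalError (hBU n) σ s).trans_le hn

theorem soccInner_subset_soccCapacity (Ka : ℕ) (hAa : 0 < Aa) (hP : ∀ k, 0 ≤ P k)
    (hA : ∀ k, 0 ≤ A k) (hN : 0 < N) (hβ : β < 1 / N) :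
    soccInner σ P A β (1 / N) ⊆ soccCapacity Ka σ Aa P A β (1 / N * σ ^ 2 / Aa ^ 2) := by
  rintro R ⟨R', hR', hR⟩
  obtain rfl : R = fun k => (1 - 1 / (N : ℝ)) * R' k := funext hR
  exact map_mem_closure (f := fun (R : Fin Kd → ℝ) k => (1 - 1 / (N : ℝ)) * R k) (by fun_prop) hR'
    fun r hr => hr.soccAchievable Ka hAa hP hA hN hβ

end Achievability

theorem theorem1_general (Ka : ℕ) {Kd : ℕ} {σ Aa β : ℝ} {P A : Fin Kd → ℝ} {N : ℕ}
    (hσ : 0 < σ) (hAa : 0 < Aa) (hP : ∀ k, 0 ≤ P k) (hA : ∀ k, 0 ≤ A k)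
    (hβ0 : 0 ≤ β) (hN : 0 < N) (hβN : β < 1 / N) :
    soccInner σ P A β (1 / N) ⊆ soccCapacity Ka σ Aa P A β (1 / N * σ ^ 2 / Aa ^ 2) ∧
    soccCapacity Ka σ Aa P A β (1 / N * σ ^ 2 / Aa ^ 2) ⊆
      soccOuter Ka σ Aa P β (1 / N * σ ^ 2 / Aa ^ 2) :=
  ⟨soccInner_subset_soccCapacity Ka hAa hP hA hN hβN,
    soccCapacity_subset_soccOuter hσ hβ0 (by positivity)⟩

theorem theorem1 (Ka Kd : ℕ) (σ Aa : ℝ) (P A : Fin Kd → ℝ) (β β' : ℝ)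
    (hσ : 0 < σ) (hAa : 0 < Aa) (hP : ∀ k, 0 < P k) (hA : ∀ k, 0 < A k)
    (hβ0 : 0 < β) (hβ1 : β < 1)
    (hβ' : IsLeast {x : ℝ | ∃ n : ℕ, 0 < n ∧ x = 1 / (n : ℝ) ∧ β < x} β') :
    soccInner σ P A β β' ⊆ soccCapacity Ka σ Aa P A β (β' * σ ^ 2 / Aa ^ 2) ∧
    soccCapacity Ka σ Aa P A β (β' * σ ^ 2 / Aa ^ 2) ⊆
      soccOuter Ka σ Aa P β (β' * σ ^ 2 / Aa ^ 2) := by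
  obtain ⟨N, hN, rfl, hβN⟩ := hβ'.1
  exact theorem1_general Ka hσ hAa (fun k => (hP k).le) (fun k => (hA k).le) hβ0.le hN hβN
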